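/- **Coercivity of the multipatch dG form.** Let $d\in\{2,3\}$, let $\Omega\subset\mathbb R^d$ be a bounded domain (open set) decomposed into pairwise disjoint open subdomains (patches) $\Omega_1,\dots,\Omega_N$ with $\overline\Omega=\bigcup_i\overline\Omega_i$. Each patch is $\Omega_i=\Phi_i((0,1)^d)$, where $\Phi_i$ is continuous and one-to-one on $[0,1]^d$ and $0<c_m\le|\det J_{\Phi_i}|\le c_M$ on $(0,1)^d$ (wherever $\Phi_i$ is differentiable); put $\Psi_i=\Phi_i^{-1}$ on $\overline\Omega_i$. For every patch take $d$ open knot vectors on $[0,1]$ of degree $k$ with interior knots of multiplicity at most $k$. They define a parametric mesh of $(0,1)^d$ into boxes $\hat E$ (micro-elements) with mesh size $h_i=\max_{\hat E}\operatorname{diam}\hat E$, and the space $\hat{\mathbb B}^{(i)}$ spanned by the tensor-product B-splines of degree $k$. It is assumed that the components of $\Phi_i$ belong to $\hat{\mathbb B}^{(i)}$ on $[0,1]^d$ and that the meshes are quasi-uniform with a constant $\theta$: $h_i\le\theta\operatorname{diam}\hat E$ and $\operatorname{diam}\hat E\le\theta\,|e|$ for every $\hat E$ and each of its edges $e$. Let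 $\mathbb B_h$ be the multipatch B-spline space of all families $u_h=(u^{(1)},\dots,u^{(N)})$ with $u^{(i)}=\hat u^{(i)}\circ\Psi_i$, $\hat u^{(i)}\in\hat{\mathbb B}^{(i)}$. Let the diffusion coefficient $\alpha$ be equal to a constant $\alpha^{(i)}>0$ on $\Omega_i$. The faces are $F_{ij}=\partial\Omega_i\cap\partial\Omega_j$ ($j\ne i$) and $F_i=\partial\Omega_i\cap\partial\Omega$; $\mathbf n$ is the unit normal pointing out of $\Omega_i$. On $F_{ij}$ put $[\![v]\!]=v^{(i)}-v^{(j)}$ and $\{\alpha\nabla v\}=\frac12(\alpha^{(i)}\nabla v^{(i)}+\alpha^{(j)}\nabla v^{(j)})$; on $F_i$ put $[\![v]\!]=v^{(i)}$, $\{\alpha\nabla v\}=\alpha^{(i)}\nabla v^{(i)}$. For a penalty parameter $\mu>0$ let $$a_h(u,v)=\sum_{i=1}^N a_i(u,v)-\sum_{i=1}^N\Big(\tfrac12 s_i(u,v)-p_i(u,v)\Big),\qquad a_i(u,v)=\int_{\Omega_i}\alpha^{(i)}\nabla u^{(i)}\cdot\nabla v^{(i)}\,dx,$$ $$s_i(u,v)=\sum_{F\subset\partial\Omega_i}\int_F\{\alpha\nabla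 u\}\cdot\mathbf n\,[\![v]\!]+\{\alpha\nabla v\}\cdot\mathbf n\,[\![u]\!]\,ds,$$ $$p_i(u,v)=\sum_{j\ne i}\int_{F_{ij}}\mu\Big(\frac{\alpha^{(j)}}{h_j}+\frac{\alpha^{(i)}}{h_i}\Big)[\![u]\!][\![v]\!]\,ds+\int_{F_i}\mu\frac{\alpha^{(i)}}{h_i}[\![u]\!][\![v]\!]\,ds,$$ where the sum in $s_i$ is over all faces $F_{ij}$, $j\neq i$, and $F_i$, and let $$\|u\|_{dG}^2=\sum_{i=1}^N\Big(\alpha^{(i)}\|\nabla u^{(i)}\|^2_{L^2(\Omega_i)}+p_i(u,u)\Big).$$ Then there are $\mu_0>0$ and $C>0$, depending only on the degree $k$, the quasi-uniformity constant $\theta$ and the fixed geometry (the domain $\Omega\subset\mathbb R^d$, its decomposition and the maps $\Phi_i$), but not on $\alpha$, on the meshes or on the mesh sizes $h_i$, such that for all $\mu\ge\mu_0$ $$a_h(u_h,u_h)\ \ge\ C\,\|u_h\|_{dG}^2\qquad\text{for all }u_h\in\mathbb B_h .$$ -/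

import Mathlib

open MeasureTheory Set Filter Topology
open scoped MeasureTheory

noncomputable section

namespace IgA

/-- Euclidean space `ℝ^d`. -/
abbrev E (d : ℕ) := EuclideanSpace ℝ (Fin d)

/-- The open parametric domain `(0,1)^d`. -/
def openCube (d : ℕ) : Set (E d) := {x | ∀ m, x m ∈ Ioo (0 : ℝ) 1}

/-- The closed parametric domain `[0,1]^d`. -/
def closedCube (d : ℕ) : Set (E d) := {x | ∀ m, x m ∈ Icc (0 : ℝ) 1}

/-! ### B-splines -/

/-- An open (clamped) knot vector `0 = ξ_0 = … = ξ_k ≤ ξ_{k+1} ≤ … ≤ ξ_{n-1} ≤ ξ_n = … = ξ_{n+k} = 1`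
for B-splines of degree `k`, with `n` basis functions and interior knots of multiplicity at most
`k` (so that the splines are continuous). The sequence is continued by `1` beyond the index `n + k`;
these values play no role. -/
structure KnotVector (k : ℕ) where
  n : ℕ
  knot : ℕ → ℝ
  mono : Monotone knot
  knot_left : ∀ j, j ≤ k → knot j = 0
  knot_right : ∀ j, n ≤ j → knot j = 1
  interior_mult : ∀ j, 0 < knot j → knot j < 1 → knot j < knot (j + k)

/-- The univariate B-spline `B_{j,p}` on the knots `ξ`, by the Cox-de Boor recursion (where
`0 / 0 = 0`). The last nonempty knot span, the one that ends at `1`, is closed on the right. -/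
def bspline (ξ : ℕ → ℝ) : ℕ → ℕ → ℝ → ℝ
  | 0, j, t =>
      open Classical in
      if (ξ j ≤ t ∧ t < ξ (j + 1)) ∨ (t = 1 ∧ ξ j < 1 ∧ ξ (j + 1) = 1) then 1 else 0
  | p + 1, j, t =>
      (t - ξ j) / (ξ (j + p + 1) - ξ j) * bspline ξ p j t
        + (ξ (j + p + 2) - t) / (ξ (j + p + 2) - ξ (j + 1)) * bspline ξ p (j + 1) t

/-- `d` knot vectors of degree `k`, one for every parametric direction. -/
abbrev Knots (d k : ℕ) := Fin d → KnotVector k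

namespace Knots

variable {d k : ℕ}

/-- Multi-indices of the tensor product basis. -/
abbrev Index (Ξ : Knots d k) := (m : Fin d) → Fin (Ξ m).n

/-- The tensor product B-spline `x ↦ B_{j_1}(x_1) ⋯ B_{j_d}(x_d)` of degree `k`. -/
def basisFun (Ξ : Knots d k) (j : Ξ.Index) (x : E d) : ℝ :=
  ∏ m, bspline (Ξ m).knot k (j m) (x m)

/-- The B-spline space on the parametric domain. -/
def splineSpace (Ξ : Knots d k) : Submodule ℝ (E d → ℝ) :=
  Submodule.span ℝ (range Ξ.basisFun)

/-- The map `Φ` is a B-spline map on the parametric domain, with control points `c j`. -/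
def Represents (Ξ : Knots d k) (Φ : E d → E d) : Prop :=
  ∃ c : Ξ.Index → E d, ∀ x ∈ closedCube d, Φ x = ∑ j, Ξ.basisFun j x • c j

/-- `e` selects a nonempty knot span in every direction. -/
def IsElement (Ξ : Knots d k) (e : Fin d → ℕ) : Prop :=
  ∀ m, (Ξ m).knot (e m) < (Ξ m).knot (e m + 1)

/-- The (closed) micro-element of the parametric mesh that belongs to the knot spans `e`. -/
def element (Ξ : Knots d k) (e : Fin d → ℕ) : Set (E d) :=
  {x | ∀ m, x m ∈ Icc ((Ξ m).knot (e m)) ((Ξ m).knot (e m + 1))}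

/-- The mesh size: the maximum of the diameters of the micro-elements of the parametric mesh. -/
def meshSize (Ξ : Knots d k) : ℝ :=
  sSup {r | ∃ e, Ξ.IsElement e ∧ r = Metric.diam (Ξ.element e)}

/-- The mesh is quasi-uniform with constant `θ`: the mesh size is bounded by `θ` times the diameter
of each micro-element, and this diameter is bounded by `θ` times the length of each edge of the
micro-element. (The reverse bounds hold with constant `1`.) -/
def QuasiUniform (Ξ : Knots d k) (θ : ℝ) : Prop :=
  ∀ e, Ξ.IsElement e →
    Ξ.meshSize ≤ θ * Metric.diam (Ξ.element e) ∧
      ∀ m, Metric.diam (Ξ.element e) ≤ θ * ((Ξ m).knot (e m + 1) - (Ξ m).knot (e m))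

end Knots

/-! ### The multipatch domain -/

/-- A decomposition of a domain `Ω ⊂ ℝ^d` into `N` non-overlapping subdomains (patches)
`sub i = Φ_i((0,1)^d)` with regular one-to-one parametrizations `Φ_i`. -/
structure Multipatch (d N : ℕ) where
  Ω : Set (E d)
  sub : Fin N → Set (E d)
  Φ : Fin N → E d → E d
  isOpen_domain : IsOpen Ω
  isOpen_sub : ∀ i, IsOpen (sub i)
  closure_domain : closure Ω = ⋃ i, closure (sub i)
  disjoint_sub : ∀ i j, j ≠ i → sub i ∩ sub j = ∅
  image_cube : ∀ i, Φ i '' openCube d = sub i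
  continuousOn : ∀ i, ContinuousOn (Φ i) (closedCube d)
  injOn : ∀ i, InjOn (Φ i) (closedCube d)
  /-- The Jacobian determinants are bounded from above and away from zero; if `Φ_i` is only
  piecewise smooth, wherever `Φ_i` is differentiable. -/
  regular : ∃ cm cM : ℝ, 0 < cm ∧ ∀ i, ∀ x ∈ openCube d, DifferentiableAt ℝ (Φ i) x →
    cm ≤ |(fderiv ℝ (Φ i) x).det| ∧ |(fderiv ℝ (Φ i) x).det| ≤ cM

/-- `ν` is the outer unit normal to `S` at `x`: to first order at `x`, the set `S` is the half space
`{y | ⟪y - x, ν⟫ < 0}`. There is at most one such vector. -/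
def IsOuterNormalAt {d : ℕ} (S : Set (E d)) (x ν : E d) : Prop :=
  ‖ν‖ = 1 ∧ ∀ ε > 0, ∀ᶠ y in 𝓝 x,
    (y ∈ S → inner ℝ (y - x) ν ≤ ε * ‖y - x‖) ∧
      (y ∉ S → -(ε * ‖y - x‖) ≤ inner ℝ (y - x) ν)

open Classical in
/-- The outer unit normal field of `S` (zero where there is no outer unit normal). -/
def outerNormal {d : ℕ} (S : Set (E d)) (x : E d) : E d :=
  if h : ∃ ν, IsOuterNormalAt S x ν then h.choose else 0

/-- Surface integral over `F ⊂ ℝ^d`, with respect to the `(d-1)`-dimensional Hausdorff measure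
(normalized so as to agree with Lebesgue measure on hyperplanes). -/
def surfaceIntegral {d : ℕ} (F : Set (E d)) (f : E d → ℝ) : ℝ :=
  ∫ x in F, f x ∂(μHE[d - 1] : Measure (E d))

namespace Multipatch

variable {d N k : ℕ}

/-- The inverse parametrization `Ψ_i = Φ_i⁻¹`, on the closed patch. -/
def Ψ (G : Multipatch d N) (i : Fin N) : E d → E d :=
  open Classical in Function.invFunOn (G.Φ i) (closedCube d)

/-- The face `F_ij = ∂Ω_i ∩ ∂Ω_j` between two patches. -/
def face (G : Multipatch d N) (i j : Fin N) : Set (E d) :=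
  frontier (G.sub i) ∩ frontier (G.sub j)

/-- The face `F_i = ∂Ω_i ∩ ∂Ω` on the boundary of the domain. -/
def boundaryFace (G : Multipatch d N) (i : Fin N) : Set (E d) :=
  frontier (G.sub i) ∩ frontier G.Ω

/-- The unit normal on `∂Ω_i`, pointing out of `Ω_i`. -/
def normal (G : Multipatch d N) (i : Fin N) (x : E d) : E d := outerNormal (G.sub i) x

/-- The B-spline space on the patch `i`: the functions `û ∘ Ψ_i`. -/
def patchSpace (G : Multipatch d N) (Ξ : Fin N → Knots d k) (i : Fin N) :
    Submodule ℝ (E d → ℝ) :=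
  (Knots.splineSpace (Ξ i)).map (LinearMap.funLeft ℝ ℝ (G.Ψ i))

/-- The multipatch B-spline space, the product of the spaces on the patches. Its elements are
families `u`, where `u i` stands for `u|_{Ω_i}` and its continuous extension to the closed patch;
its values off the closed patch are irrelevant. -/
def space (G : Multipatch d N) (Ξ : Fin N → Knots d k) : Submodule ℝ (Fin N → E d → ℝ) :=
  Submodule.pi univ (G.patchSpace Ξ)

/-- The gradient of `u|_{Ω_i}`, up to the boundary (one-sided there). -/
def grad (G : Multipatch d N) (u : Fin N → E d → ℝ) (i : Fin N) (x : E d) : E d :=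
  gradientWithin (u i) (closure (G.sub i)) x

/-- The jump `u|_{Ω_i} - u|_{Ω_j}` on `F_ij`. -/
def jump (u : Fin N → E d → ℝ) (i j : Fin N) (x : E d) : ℝ := u i x - u j x

/-- The average of `α ∇u` on `F_ij`. -/
def avgFlux (G : Multipatch d N) (α : Fin N → ℝ) (u : Fin N → E d → ℝ) (i j : Fin N) (x : E d) :
    E d :=
  (1 / 2 : ℝ) • (α i • G.grad u i x + α j • G.grad u j x)

/-- `a_i(u,v) = ∫_{Ω_i} α ∇u · ∇v dx`. -/
def formA (G : Multipatch d N) (α : Fin N → ℝ) (i : Fin N) (u v : Fin N → E d → ℝ) : ℝ :=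
  ∫ x in G.sub i, α i * inner ℝ (G.grad u i x) (G.grad v i x)

/-- `s_i(u,v)`: the sum over the faces `F ⊂ ∂Ω_i` of `∫_F {α∇u}·n ⟦v⟧ + {α∇v}·n ⟦u⟧ ds`, where on
boundary faces average and jump are the values from `Ω_i`. -/
def formS (G : Multipatch d N) (α : Fin N → ℝ) (i : Fin N) (u v : Fin N → E d → ℝ) : ℝ :=
  (∑ j ∈ Finset.univ.filter (fun j => j ≠ i), surfaceIntegral (G.face i j) fun x =>
      inner ℝ (G.avgFlux α u i j x) (G.normal i x) * jump v i j x
        + inner ℝ (G.avgFlux α v i j x) (G.normal i x) * jump u i j x)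
    + surfaceIntegral (G.boundaryFace i) fun x =>
      inner ℝ (α i • G.grad u i x) (G.normal i x) * v i x
        + inner ℝ (α i • G.grad v i x) (G.normal i x) * u i x

/-- `p_i(u,v)`: the sum over the faces `F ⊂ ∂Ω_i` of `∫_F μ (α_j/h_j + α_i/h_i) ⟦u⟧ ⟦v⟧ ds`, without
the term `α_j/h_j` on boundary faces. -/
def formP (G : Multipatch d N) (Ξ : Fin N → Knots d k) (α : Fin N → ℝ) (μ : ℝ) (i : Fin N)
    (u v : Fin N → E d → ℝ) : ℝ :=
  (∑ j ∈ Finset.univ.filter (fun j => j ≠ i), surfaceIntegral (G.face i j) fun x =>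
      μ * (α j / (Ξ j).meshSize + α i / (Ξ i).meshSize) * jump u i j x * jump v i j x)
    + surfaceIntegral (G.boundaryFace i) fun x =>
      μ * (α i / (Ξ i).meshSize) * u i x * v i x

/-- The symmetric interior penalty form `a_h(u,v) = ∑ a_i(u,v) - ∑ (s_i(u,v)/2 - p_i(u,v))`. -/
def formH (G : Multipatch d N) (Ξ : Fin N → Knots d k) (α : Fin N → ℝ) (μ : ℝ)
    (u v : Fin N → E d → ℝ) : ℝ :=
  ∑ i, G.formA α i u v - ∑ i, (1 / 2 * G.formS α i u v - G.formP Ξ α μ i u v)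

/-- The dG norm, `‖u‖_dG² = ∑ (α_i ‖∇u_i‖²_{L²(Ω_i)} + p_i(u,u))`. -/
def dgNorm (G : Multipatch d N) (Ξ : Fin N → Knots d k) (α : Fin N → ℝ) (μ : ℝ)
    (u : Fin N → E d → ℝ) : ℝ :=
  √(∑ i, (α i * (∫ x in G.sub i, ‖G.grad u i x‖ ^ 2) + G.formP Ξ α μ i u u))

end Multipatch

end IgA

end

/-!
The form is coercive because the consistency terms `s_i` are controlled by the gradient terms and
the penalty terms, through an inverse trace inequality on each patch,
`h_i ∫_{∂Ω_i} |∇u_i|² ≤ K ∫_{Ω_i} |∇u_i|²` for all `u_i` in the B-spline space, with `K` depending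
only on the degree, the quasi-uniformity constant and the geometry
(`Multipatch.exists_trace_majorant`). Young's inequality with a weight proportional to `h_i` then
bounds the consistency terms by half of the gradient terms plus `K (N + 1) / 2` times the penalty
terms for `μ = 1` (`Multipatch.half_formS_le`), so that `μ₀ = K (N + 1)` and `C = 1 / 2` will do.

For the trace inequality, `∂Ω_i` is the image of the boundary of the cube under `Φ_i`. In the
parametric domain, a partial derivative of a spline is, along a line orthogonal to a facet, a
polynomial of degree at most `k` on the knot span next to the facet. The inverse trace inequality
for polynomials in one variable (`exists_sq_eval_zero_le_integral`, by compactness), scaled to this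
span, whose length is comparable to `h_i`, and integrated over the facet gives the trace inequality
on the cube (`Knots.exists_lintegral_facet_le`).

To pass to the patch only one-sided bounds are needed. A spline has a bounded derivative from the
right along each coordinate line, at every point, so the continuous map `Φ_i` is Lipschitz on the
closed cube (`Knots.exists_lipschitzOnWith_spline`); its constant does not depend on the mesh
used to represent it. Hence surface integrals over `∂Ω_i` are bounded by integrals over the facets
(`lintegral_lipschitz_image_le`), and, since the Jacobian determinant is bounded away from zero, the
derivative of `Φ_i` has a bounded inverse (`exists_mul_norm_le_norm_apply`), up to the boundary. So
the gradients of `u_i` and of `u_i ∘ Φ_i` are comparable at the images of all points off the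
interior knot lines (`Multipatch.gradientWithin_bounds`), which is almost everywhere both in the
patch and on its boundary. The change of variables formula concludes.
-/

noncomputable section

namespace IgA

/-! ### Univariate B-splines and their derivatives -/

/-- The derivative of the B-spline `B_{j,p}`, obtained by differentiating the Cox-de Boor recursion
term by term. At a knot it is the derivative from the right (at `1`, from the left). -/
def bsplineDeriv (ξ : ℕ → ℝ) : ℕ → ℕ → ℝ → ℝ
  | 0, _, _ => 0
  | p + 1, j, t =>
      (1 / (ξ (j + p + 1) - ξ j) * bspline ξ p j t
          + (t - ξ j) / (ξ (j + p + 1) - ξ j) * bsplineDeriv ξ p j t)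
        + (-1 / (ξ (j + p + 2) - ξ (j + 1)) * bspline ξ p (j + 1) t
          + (ξ (j + p + 2) - t) / (ξ (j + p + 2) - ξ (j + 1)) * bsplineDeriv ξ p (j + 1) t)

/-- Where the B-splines of degree zero are locally constant, `bsplineDeriv` is the derivative. -/
lemma hasDerivWithinAt_bspline {ξ : ℕ → ℝ} {s : Set ℝ} {t : ℝ}
    (h : ∀ᶠ r in 𝓝[s] t, ∀ j, bspline ξ 0 j r = bspline ξ 0 j t) (p j : ℕ) :
    HasDerivWithinAt (bspline ξ p j) (bsplineDeriv ξ p j t) s t := by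
  induction p generalizing j with
  | zero =>
    refine (hasDerivWithinAt_const t s (bspline ξ 0 j t)).congr_of_eventuallyEq ?_ rfl
    exact h.mono fun r hr => hr j
  | succ p ih =>
    have h1 := (((hasDerivWithinAt_id t s).sub_const (ξ j)).div_const
      (ξ (j + p + 1) - ξ j)).mul (ih j)
    have h2 := (((hasDerivWithinAt_id t s).const_sub (ξ (j + p + 2))).div_const
      (ξ (j + p + 2) - ξ (j + 1))).mul (ih (j + 1))
    exact h1.add h2

lemma differentiableWithinAt_bsplineDeriv {ξ : ℕ → ℝ} {s : Set ℝ} {t : ℝ}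
    (h : ∀ᶠ r in 𝓝[s] t, ∀ j, bspline ξ 0 j r = bspline ξ 0 j t) (p j : ℕ) :
    DifferentiableWithinAt ℝ (bsplineDeriv ξ p j) s t := by
  induction p generalizing j with
  | zero => exact differentiableWithinAt_const (0 : ℝ)
  | succ p ih =>
    have hB := fun i => (hasDerivWithinAt_bspline h p i).differentiableWithinAt
    have hid : DifferentiableWithinAt ℝ (fun r : ℝ => r) s t := differentiableWithinAt_id
    exact (((hB j).const_mul _).add (((hid.sub_const _).div_const _).mul (ih j))).add
      (((hB (j + 1)).const_mul _).add (((hid.const_sub _).div_const _).mul (ih (j + 1))))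

lemma measurable_bspline (ξ : ℕ → ℝ) (p j : ℕ) : Measurable (bspline ξ p j) := by
  induction p generalizing j with
  | zero =>
    change Measurable fun t => bspline ξ 0 j t
    unfold bspline
    refine Measurable.ite ?_ measurable_const measurable_const
    exact (measurableSet_Ico (a := ξ j) (b := ξ (j + 1))).union
      ((measurableSet_singleton (1 : ℝ)).inter (MeasurableSet.const _))
  | succ p ih =>
    exact (((measurable_id.sub_const _).div_const _).mul (ih j)).add
      (((measurable_id.const_sub _).div_const _).mul (ih (j + 1)))

lemma measurable_bsplineDeriv (ξ : ℕ → ℝ) (p j : ℕ) : Measurable (bsplineDeriv ξ p j) := by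
  induction p generalizing j with
  | zero => exact measurable_const
  | succ p ih =>
    have hB := measurable_bspline ξ p
    exact (((hB j).const_mul _).add (((measurable_id.sub_const _).div_const _).mul (ih j))).add
      (((hB (j + 1)).const_mul _).add (((measurable_id.const_sub _).div_const _).mul (ih (j + 1))))

/-- The knot span `[ξ_e, ξ_{e+1})`, closed on the right if it ends at `1`, to match the convention
for B-splines of degree zero. -/
def knotSpan (ξ : ℕ → ℝ) (e : ℕ) : Set ℝ :=
  {t | ξ e ≤ t ∧ t ≤ ξ (e + 1) ∧ (t < ξ (e + 1) ∨ t = 1)}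

namespace KnotVector

variable {k : ℕ} (κ : KnotVector k)

lemma knot_nonneg (j : ℕ) : 0 ≤ κ.knot j :=
  (κ.knot_left 0 (Nat.zero_le _)).symm.trans_le (κ.mono (Nat.zero_le j))

lemma knot_le_one (j : ℕ) : κ.knot j ≤ 1 :=
  (κ.mono (le_max_left j κ.n)).trans_eq (κ.knot_right _ (le_max_right j κ.n))

variable {κ}

lemma bspline_zero_of_mem_knotSpan {e : ℕ} (he : κ.knot e < κ.knot (e + 1)) {t : ℝ}
    (ht : t ∈ knotSpan κ.knot e) (j : ℕ) :
    bspline κ.knot 0 j t = if j = e then 1 else 0 := by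
  obtain ⟨h1, h2, h3⟩ := ht
  unfold bspline
  rcases lt_trichotomy j e with hj | rfl | hj
  · have hle : κ.knot (j + 1) ≤ κ.knot e := κ.mono hj
    have := κ.knot_le_one (e + 1)
    rw [if_neg, if_neg hj.ne]
    rintro (⟨-, h⟩ | ⟨-, -, h⟩) <;> linarith
  · rw [if_pos, if_pos rfl]
    rcases h3 with h3 | h3
    · exact Or.inl ⟨h1, h3⟩
    · subst h3
      have := κ.knot_le_one (j + 1)
      exact Or.inr ⟨rfl, he.trans_le this, le_antisymm this h2⟩
  · have hle : κ.knot (e + 1) ≤ κ.knot j := κ.mono hj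
    have := κ.knot_le_one (j + 1)
    rw [if_neg, if_neg hj.ne']
    rintro (⟨h, h'⟩ | ⟨h, h', -⟩) <;> rcases h3 with h3 | h3 <;> linarith

/-- Every point of `[0,1]` lies in a nonempty knot span. -/
lemma exists_mem_knotSpan {t : ℝ} (ht : t ∈ Icc (0 : ℝ) 1) :
    ∃ e, κ.knot e < κ.knot (e + 1) ∧ t ∈ knotSpan κ.knot e := by
  classical
  rcases ht.2.lt_or_eq with h1 | rfl
  · have hex : ∃ j, t < κ.knot j := ⟨κ.n, by rwa [κ.knot_right _ le_rfl]⟩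
    have hs := Nat.find_spec hex
    have h0 : Nat.find hex ≠ 0 := fun h => by
      rw [h, κ.knot_left 0 (Nat.zero_le _)] at hs
      exact hs.not_ge ht.1
    obtain ⟨e, he⟩ := Nat.exists_eq_succ_of_ne_zero h0
    have hm := not_lt.1 (Nat.find_min hex (m := e) (by omega))
    rw [he] at hs
    exact ⟨e, hm.trans_lt hs, hm, hs.le, Or.inl hs⟩
  · have hex : ∃ j, 1 ≤ κ.knot j := ⟨κ.n, (κ.knot_right _ le_rfl).ge⟩
    have hs := Nat.find_spec hex
    have h0 : Nat.find hex ≠ 0 := fun h => by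
      rw [h, κ.knot_left 0 (Nat.zero_le _)] at hs
      linarith
    obtain ⟨e, he⟩ := Nat.exists_eq_succ_of_ne_zero h0
    have hm := not_le.1 (Nat.find_min hex (m := e) (by omega))
    rw [he] at hs
    exact ⟨e, hm.trans_le hs, hm.le, hs, Or.inr rfl⟩

lemma bspline_zero_eq_of_mem_knotSpan {e : ℕ} (he : κ.knot e < κ.knot (e + 1)) {t r : ℝ}
    (ht : t ∈ knotSpan κ.knot e) (hr : r ∈ knotSpan κ.knot e) (j : ℕ) :
    bspline κ.knot 0 j r = bspline κ.knot 0 j t := by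
  rw [bspline_zero_of_mem_knotSpan he ht, bspline_zero_of_mem_knotSpan he hr]

variable (κ) in
/-- A parameter `t` is a regular point if, near `t`, the interval `[0,1]` lies in the knot span of
`t`, so that all splines are polynomials near `t`: this is so unless `t` is an interior knot. -/
def IsRegularPoint (t : ℝ) : Prop :=
  t ∈ Icc (0 : ℝ) 1 ∧
    ∀ᶠ r in 𝓝[Icc (0 : ℝ) 1] t, ∀ j, bspline κ.knot 0 j r = bspline κ.knot 0 j t

lemma isRegularPoint_of_forall_ne {t : ℝ} (ht : t ∈ Icc (0 : ℝ) 1)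
    (h : t = 0 ∨ t = 1 ∨ ∀ j, t ≠ κ.knot j) : κ.IsRegularPoint t := by
  refine ⟨ht, ?_⟩
  obtain ⟨e, he, hte⟩ := exists_mem_knotSpan (κ := κ) ht
  suffices hs : ∀ᶠ r in 𝓝[Icc (0 : ℝ) 1] t, r ∈ knotSpan κ.knot e from
    hs.mono fun r hr j => bspline_zero_eq_of_mem_knotSpan he hte hr j
  obtain ⟨h1, h2, h3⟩ := hte
  have hlow : ∀ᶠ r in 𝓝[Icc (0 : ℝ) 1] t, κ.knot e ≤ r := by
    rcases h1.lt_or_eq with h1 | h1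
    · exact mem_nhdsWithin_of_mem_nhds (Ici_mem_nhds h1)
    · rcases h with h | h | h
      · filter_upwards [self_mem_nhdsWithin] with r hr
        rw [h1, h]; exact hr.1
      · have := κ.knot_le_one (e + 1); linarith
      · exact absurd h1.symm (h e)
  rcases h3 with h3 | h3
  · filter_upwards [hlow, mem_nhdsWithin_of_mem_nhds (Iio_mem_nhds h3)] with r hr hr'
    exact ⟨hr, le_of_lt hr', Or.inl hr'⟩
  · filter_upwards [hlow, self_mem_nhdsWithin] with r hr hr'
    have h4 : κ.knot (e + 1) = 1 := le_antisymm (κ.knot_le_one _) (h3 ▸ h2)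
    refine ⟨hr, h4 ▸ hr'.2, ?_⟩
    rw [h4]
    exact hr'.2.lt_or_eq

lemma IsRegularPoint.eventually {t : ℝ} (h : κ.IsRegularPoint t) :
    ∀ᶠ r in 𝓝[Icc (0 : ℝ) 1] t, κ.IsRegularPoint r := by
  filter_upwards [eventually_eventually_nhdsWithin.2 h.2, h.2, self_mem_nhdsWithin]
    with r hr hr' hr''
  exact ⟨hr'', hr.mono fun q hq j => (hq j).trans (hr' j).symm⟩

lemma IsRegularPoint.hasDerivWithinAt {t : ℝ} (h : κ.IsRegularPoint t) (p j : ℕ) :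
    HasDerivWithinAt (bspline κ.knot p j) (bsplineDeriv κ.knot p j t) (Icc 0 1) t :=
  hasDerivWithinAt_bspline h.2 p j

lemma IsRegularPoint.continuousWithinAt_bsplineDeriv {t : ℝ} (h : κ.IsRegularPoint t) (p j : ℕ) :
    ContinuousWithinAt (bsplineDeriv κ.knot p j) (Icc 0 1) t :=
  (differentiableWithinAt_bsplineDeriv h.2 p j).continuousWithinAt

/-- B-splines are differentiable from the right at every point of `[0,1)`, knots included. -/
lemma hasDerivWithinAt_Ici_bspline {t : ℝ} (ht : t ∈ Ico (0 : ℝ) 1) (p j : ℕ) :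
    HasDerivWithinAt (bspline κ.knot p j) (bsplineDeriv κ.knot p j t) (Ici t) t := by
  obtain ⟨e, he, hte⟩ := exists_mem_knotSpan (κ := κ) ⟨ht.1, ht.2.le⟩
  have h3 : t < κ.knot (e + 1) := hte.2.2.resolve_right ht.2.ne
  refine hasDerivWithinAt_bspline ?_ p j
  filter_upwards [self_mem_nhdsWithin, mem_nhdsWithin_of_mem_nhds (Iio_mem_nhds h3)] with r hr hr'
  exact bspline_zero_eq_of_mem_knotSpan he hte ⟨hte.1.trans hr, le_of_lt hr', Or.inl hr'⟩

end KnotVector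

/-- Bounded functions on `[0,1]` form an algebra; the B-splines and their derivatives are obtained
within it from bounded functions. -/
lemma exists_abs_mul_add_mul_le {s : Set ℝ} {f g f' g' : ℝ → ℝ}
    (hf : ∃ M, ∀ t ∈ s, |f t| ≤ M) (hg : ∃ M, ∀ t ∈ s, |g t| ≤ M)
    (hf' : ∃ M, ∀ t ∈ s, |f' t| ≤ M) (hg' : ∃ M, ∀ t ∈ s, |g' t| ≤ M) :
    ∃ M, ∀ t ∈ s, |f t * g t + f' t * g' t| ≤ M := by
  obtain ⟨a, ha⟩ := hf
  obtain ⟨b, hb⟩ := hg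
  obtain ⟨c, hc⟩ := hf'
  obtain ⟨d, hd⟩ := hg'
  refine ⟨a * b + c * d, fun t ht => (abs_add_le _ _).trans ?_⟩
  rw [abs_mul, abs_mul]
  have := (abs_nonneg _).trans (ha t ht)
  have := (abs_nonneg _).trans (hc t ht)
  gcongr
  exacts [ha t ht, hb t ht, hc t ht, hd t ht]

lemma exists_forall_abs_le_of_continuous {f : ℝ → ℝ} (hf : Continuous f) :
    ∃ M, ∀ t ∈ Icc (0 : ℝ) 1, |f t| ≤ M :=
  isCompact_Icc.exists_bound_of_continuousOn hf.continuousOn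

lemma exists_forall_abs_bspline_le (ξ : ℕ → ℝ) (p j : ℕ) :
    ∃ M, ∀ t ∈ Icc (0 : ℝ) 1, |bspline ξ p j t| ≤ M := by
  induction p generalizing j with
  | zero =>
    refine ⟨1, fun t _ => ?_⟩
    unfold bspline
    split_ifs <;> simp
  | succ p ih =>
    exact exists_abs_mul_add_mul_le
      (exists_forall_abs_le_of_continuous ((continuous_id.sub continuous_const).div_const _)) (ih j)
      (exists_forall_abs_le_of_continuous ((continuous_const.sub continuous_id).div_const _))
      (ih (j + 1))

lemma exists_forall_abs_bsplineDeriv_le (ξ : ℕ → ℝ) (p j : ℕ) :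
    ∃ M, ∀ t ∈ Icc (0 : ℝ) 1, |bsplineDeriv ξ p j t| ≤ M := by
  induction p generalizing j with
  | zero => exact ⟨0, fun t _ => by simp [bsplineDeriv]⟩
  | succ p ih =>
    have hB := exists_forall_abs_bspline_le ξ p
    obtain ⟨M, hM⟩ := exists_abs_mul_add_mul_le
      (exists_forall_abs_le_of_continuous (continuous_const (y := 1 / (ξ (j + p + 1) - ξ j))))
      (hB j) (exists_forall_abs_le_of_continuous
        ((continuous_id.sub (continuous_const (y := ξ j))).div_const (ξ (j + p + 1) - ξ j))) (ih j)
    obtain ⟨M', hM'⟩ := exists_abs_mul_add_mul_le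
      (exists_forall_abs_le_of_continuous
        (continuous_const (y := -1 / (ξ (j + p + 2) - ξ (j + 1)))))
      (hB (j + 1)) (exists_forall_abs_le_of_continuous
        (((continuous_const (y := ξ (j + p + 2))).sub continuous_id).div_const
          (ξ (j + p + 2) - ξ (j + 1)))) (ih (j + 1))
    exact ⟨M + M', fun t ht => (abs_add_le _ _).trans (add_le_add (hM t ht) (hM' t ht))⟩

/-- On a nonempty knot span, `B_{j,p}` and its derivative are polynomials of degree at most `p`. -/
lemma exists_polynomial_bspline {k : ℕ} {κ : KnotVector k} {e : ℕ}
    (he : κ.knot e < κ.knot (e + 1)) (p j : ℕ) :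
    ∃ P Q : Polynomial ℝ, P.natDegree ≤ p ∧ Q.natDegree ≤ p ∧ ∀ t ∈ knotSpan κ.knot e,
      bspline κ.knot p j t = P.eval t ∧ bsplineDeriv κ.knot p j t = Q.eval t := by
  open Polynomial in
  induction p generalizing j with
  | zero =>
    refine ⟨C (if j = e then 1 else 0), 0, (natDegree_C _).le, by simp, fun t ht => ?_⟩
    rw [KnotVector.bspline_zero_of_mem_knotSpan he ht, eval_C]
    exact ⟨rfl, eval_zero.symm⟩
  | succ p ih =>
    obtain ⟨P, Q, hP, hQ, h⟩ := ih j
    obtain ⟨P', Q', hP', hQ', h'⟩ := ih (j + 1)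
    set ξ := κ.knot
    have hl : ∀ a b : ℝ, (C a * (X - C b) : ℝ[X]).natDegree ≤ 1 := fun a b =>
      (natDegree_C_mul_le _ _).trans (natDegree_X_sub_C_le _)
    have hc : ∀ (a : ℝ) (R : ℝ[X]), R.natDegree ≤ p → (C a * R).natDegree ≤ p + 1 := fun a R hR =>
      (natDegree_C_mul_le _ _).trans (by omega)
    have hm : ∀ (a b : ℝ) (R : ℝ[X]), R.natDegree ≤ p →
        (C a * (X - C b) * R).natDegree ≤ p + 1 := fun a b R hR =>
      natDegree_mul_le.trans (by have := hl a b; omega)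
    refine ⟨C (ξ (j + p + 1) - ξ j)⁻¹ * (X - C (ξ j)) * P
        + C (-(ξ (j + p + 2) - ξ (j + 1))⁻¹) * (X - C (ξ (j + p + 2))) * P',
      (C (ξ (j + p + 1) - ξ j)⁻¹ * P + C (ξ (j + p + 1) - ξ j)⁻¹ * (X - C (ξ j)) * Q)
        + (C (-(ξ (j + p + 2) - ξ (j + 1))⁻¹) * P'
          + C (-(ξ (j + p + 2) - ξ (j + 1))⁻¹) * (X - C (ξ (j + p + 2))) * Q'),
      natDegree_add_le_of_degree_le (hm _ _ _ hP) (hm _ _ _ hP'),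
      natDegree_add_le_of_degree_le
        (natDegree_add_le_of_degree_le (hc _ _ hP) (hm _ _ _ hQ))
        (natDegree_add_le_of_degree_le (hc _ _ hP') (hm _ _ _ hQ')), fun t ht => ?_⟩
    obtain ⟨h1, h2⟩ := h t ht
    obtain ⟨h3, h4⟩ := h' t ht
    simp only [bspline, bsplineDeriv, h1, h2, h3, h4, eval_add, eval_mul, eval_C, eval_sub, eval_X,
      div_eq_mul_inv]
    constructor <;> ring

/-! ### The inverse trace inequality for polynomials -/

open Polynomial in
/-- On the finite dimensional space of polynomials of degree at most `k`, the value at an end point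
of `[0,1]` is bounded by the `L²` norm. -/
lemma exists_sq_eval_zero_le_integral (k : ℕ) : ∃ C > (0 : ℝ), ∀ P : ℝ[X], P.natDegree ≤ k →
    P.eval 0 ^ 2 ≤ C * ∫ t in (0 : ℝ)..1, P.eval t ^ 2 := by
  let p : (Fin (k + 1) → ℝ) → ℝ → ℝ := fun c t => ∑ i, c i * t ^ (i : ℕ)
  have hp : Continuous (Function.uncurry p) := by
    unfold p Function.uncurry; fun_prop
  have hJ : Continuous fun c => ∫ t in (0 : ℝ)..1, p c t ^ 2 :=
    intervalIntegral.continuous_parametric_intervalIntegral_of_continuous' (hp.pow 2) _ _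
  have hpos : ∀ c ≠ 0, 0 < ∫ t in (0 : ℝ)..1, p c t ^ 2 := by
    intro c hc
    by_contra hle
    apply hc
    have hcont : Continuous (p c) := hp.comp (continuous_const.prodMk continuous_id)
    have hz : ∀ t ∈ Ioo (0 : ℝ) 1, p c t = 0 := by
      intro t ht
      by_contra hne
      refine hle (intervalIntegral.integral_pos zero_lt_one (hcont.pow 2).continuousOn
        (fun _ _ => sq_nonneg _) ⟨t, Ioo_subset_Icc_self ht, by positivity⟩)
    let Q : ℝ[X] := ∑ i : Fin (k + 1), C (c i) * X ^ (i : ℕ)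
    have hQ : Q = 0 := by
      refine Polynomial.eq_zero_of_infinite_isRoot Q ((Ioo_infinite zero_lt_one).mono fun t ht => ?_)
      simpa [Q, IsRoot, eval_finsetSum, p] using hz t ht
    funext i
    have := congrArg (fun R => coeff R (i : ℕ)) hQ
    simpa [Q, finsetSum_coeff, coeff_X_pow, Fin.val_inj] using this
  obtain ⟨c₀, hc₀, hmin⟩ := (isCompact_sphere (0 : Fin (k + 1) → ℝ) 1).exists_isMinOn
    (NormedSpace.sphere_nonempty.2 zero_le_one) hJ.continuousOn
  have hm := hpos c₀ (by rintro rfl; simp at hc₀)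
  set m := ∫ t in (0 : ℝ)..1, p c₀ t ^ 2 with hmdef
  refine ⟨m⁻¹, inv_pos.2 hm, fun P hP => ?_⟩
  let c : Fin (k + 1) → ℝ := fun i => P.coeff i
  have hPc : ∀ t, P.eval t = p c t := fun t => by
    rw [eval_eq_sum_range' (Nat.lt_succ_of_le hP), ← Fin.sum_univ_eq_sum_range
      (fun i => P.coeff i * t ^ i)]
  have h0 : P.eval 0 = c 0 := by simp [c, coeff_zero_eq_eval_zero]
  rw [h0]
  simp only [hPc]
  have hc0 : c 0 ^ 2 ≤ ‖c‖ ^ 2 := sq_le_sq' (by linarith [neg_le_of_abs_le (norm_le_pi_norm c 0)])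
    (le_of_abs_le (norm_le_pi_norm c 0))
  refine hc0.trans ?_
  rw [le_inv_mul_iff₀ hm]
  rcases eq_or_ne c 0 with hc | hc
  · rw [hc]; simp [p]
  have hn : 0 < ‖c‖ := norm_pos_iff.2 hc
  have hs : ‖c‖⁻¹ • c ∈ Metric.sphere (0 : Fin (k + 1) → ℝ) 1 := by
    simp [norm_smul, hn.ne']
  have hscale : ∀ t, p c t ^ 2 = ‖c‖ ^ 2 * p (‖c‖⁻¹ • c) t ^ 2 := fun t => by
    have : p (‖c‖⁻¹ • c) t = ‖c‖⁻¹ * p c t := by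
      simp only [p, Pi.smul_apply, smul_eq_mul, Finset.mul_sum, mul_assoc]
    rw [this]; field_simp
  simp only [hscale]
  rw [intervalIntegral.integral_const_mul, mul_comm]
  gcongr
  exact hmin hs

open Polynomial in
/-- The inverse trace inequality on an interval of length `|b - a|`, at the end point `a`. -/
lemma exists_abs_mul_sq_eval_le_lintegral (k : ℕ) : ∃ C > (0 : ℝ), ∀ P : ℝ[X], P.natDegree ≤ k →
    ∀ a b : ℝ, ENNReal.ofReal (|b - a| * P.eval a ^ 2)
      ≤ ENNReal.ofReal C * ∫⁻ t in uIoo a b, ENNReal.ofReal (P.eval t ^ 2) := by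
  obtain ⟨K, hK, h⟩ := exists_sq_eval_zero_le_integral k
  refine ⟨K, hK, fun P hP a b => ?_⟩
  rcases eq_or_ne a b with rfl | hab
  · simp
  have hab' : b - a ≠ 0 := sub_ne_zero.2 hab.symm
  have h1 := h (P.comp (C a + C (b - a) * X)) (by
    refine natDegree_comp_le.trans ?_
    have : (C a + C (b - a) * X : ℝ[X]).natDegree ≤ 1 := by compute_degree
    nlinarith)
  have h2 : ∫ t in (0 : ℝ)..1, (P.comp (C a + C (b - a) * X)).eval t ^ 2
      = (b - a)⁻¹ * ∫ t in a..b, P.eval t ^ 2 := by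
    have := intervalIntegral.integral_comp_add_mul (a := 0) (b := 1) (fun t => P.eval t ^ 2) hab' a
    simpa using this
  have h3 : (b - a)⁻¹ * ∫ t in a..b, P.eval t ^ 2
      = |b - a|⁻¹ * ∫ t in uIoo a b, P.eval t ^ 2 := by
    rcases hab.lt_or_gt with hlt | hlt
    · rw [intervalIntegral.integral_of_le hlt.le, integral_Ioc_eq_integral_Ioo,
        uIoo_of_lt hlt, abs_of_pos (sub_pos.2 hlt)]
    · rw [intervalIntegral.integral_of_ge hlt.le, integral_Ioc_eq_integral_Ioo,
        uIoo_of_gt hlt, abs_of_neg (sub_neg.2 hlt)]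
      rw [mul_neg, ← neg_mul, ← inv_neg]
  have hint : IntegrableOn (fun t => P.eval t ^ 2) (uIoo a b) :=
    ((P.continuous.pow 2).integrableOn_uIcc).mono_set uIoo_subset_uIcc_self
  rw [h2, h3] at h1
  rw [← ofReal_integral_eq_lintegral_ofReal hint (ae_of_all _ fun _ => sq_nonneg _),
    ← ENNReal.ofReal_mul hK.le]
  refine ENNReal.ofReal_le_ofReal ?_
  have hpos : 0 < |b - a| := abs_pos.2 hab'
  simp only [eval_comp, eval_add, eval_mul, eval_C, eval_X, mul_zero, add_zero] at h1
  calc |b - a| * P.eval a ^ 2 ≤ |b - a| * (K * (|b - a|⁻¹ * ∫ t in uIoo a b, P.eval t ^ 2)) := by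
        gcongr
    _ = _ := by field_simp

/-! ### Tensor product splines -/

lemma isCompact_closedCube (d : ℕ) : IsCompact (closedCube d) := by
  have : closedCube d = (EuclideanSpace.equiv (Fin d) ℝ).toHomeomorph ⁻¹'
      (univ.pi fun _ => Icc (0 : ℝ) 1) := by
    ext x
    exact ⟨fun h m _ => h m, fun h m => h m (mem_univ m)⟩
  rw [this, Homeomorph.isCompact_preimage]
  exact isCompact_univ_pi fun _ => isCompact_Icc

lemma isClosed_closedCube (d : ℕ) : IsClosed (closedCube d) := (isCompact_closedCube d).isClosed

lemma isOpen_openCube (d : ℕ) : IsOpen (openCube d) := by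
  simp only [openCube, ofPred_forall]
  exact isOpen_iInter_of_finite fun m => isOpen_Ioo.preimage (by fun_prop)

lemma openCube_subset_closedCube (d : ℕ) : openCube d ⊆ closedCube d :=
  fun _ hx m => Ioo_subset_Icc_self (hx m)

lemma convex_closedCube (d : ℕ) : Convex ℝ (closedCube d) := by
  intro x hx y hy a b ha hb hab m
  exact convex_Icc (0 : ℝ) 1 (hx m) (hy m) ha hb hab

lemma openCube_nonempty (d : ℕ) : (openCube d).Nonempty :=
  ⟨WithLp.toLp 2 fun _ => 1 / 2, fun m => by norm_num⟩

lemma closedCube_subset_closure_openCube (d : ℕ) : closedCube d ⊆ closure (openCube d) := by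
  obtain ⟨c, hc⟩ := openCube_nonempty d
  intro x hx
  have hlim : Tendsto (fun t : ℝ => x + t • (c - x)) (𝓝[>] 0) (𝓝 x) := by
    have : Tendsto (fun t : ℝ => x + t • (c - x)) (𝓝 0) (𝓝 (x + (0 : ℝ) • (c - x))) :=
      (Continuous.tendsto (by fun_prop) _)
    rw [zero_smul, add_zero] at this
    exact this.mono_left nhdsWithin_le_nhds
  refine mem_closure_of_tendsto hlim ?_
  filter_upwards [Ioo_mem_nhdsGT (zero_lt_one' ℝ)] with t ht m
  have h1 := hx m
  have h2 := hc m
  simp only [PiLp.add_apply, PiLp.smul_apply, PiLp.sub_apply, smul_eq_mul]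
  constructor
  · nlinarith [h1.1, h2.1, ht.1, ht.2, mul_pos ht.1 h2.1]
  · nlinarith [h1.2, h2.2, ht.1, ht.2, mul_pos ht.1 (sub_pos.2 h2.2)]

lemma uniqueDiffOn_closedCube (d : ℕ) : UniqueDiffOn ℝ (closedCube d) := by
  refine uniqueDiffOn_convex (convex_closedCube d) ((openCube_nonempty d).mono ?_)
  exact interior_maximal (openCube_subset_closedCube d) (isOpen_openCube d)

namespace Knots

variable {d k : ℕ} (Ξ : Knots d k) {F : Type*} [NormedAddCommGroup F] [NormedSpace ℝ F]

/-- The partial derivative in direction `m` of a tensor product B-spline. -/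
def basisPartial (J : Ξ.Index) (m : Fin d) (x : E d) : ℝ :=
  ∏ m', if m' = m then bsplineDeriv (Ξ m').knot k (J m') (x m')
    else bspline (Ξ m').knot k (J m') (x m')

/-- The spline with coefficients `c`. -/
def spline (c : Ξ.Index → F) (x : E d) : F := ∑ J, Ξ.basisFun J x • c J

/-- The partial derivative in direction `m` of the spline with coefficients `c`. -/
def splinePartial (c : Ξ.Index → F) (m : Fin d) (x : E d) : F := ∑ J, Ξ.basisPartial J m x • c J

/-- The derivative of the spline with coefficients `c`. -/
def splineDeriv (c : Ξ.Index → F) (x : E d) : E d →L[ℝ] F :=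
  ∑ m, (EuclideanSpace.proj m : E d →L[ℝ] ℝ).smulRight (Ξ.splinePartial c m x)

lemma splineDeriv_apply (c : Ξ.Index → F) (x v : E d) :
    Ξ.splineDeriv c x v = ∑ m, v m • Ξ.splinePartial c m x := by
  simp [splineDeriv]

/-- A regular point of the closed parametric domain: no coordinate is an interior knot. -/
def IsRegular (x : E d) : Prop := ∀ m, (Ξ m).IsRegularPoint (x m)

variable {Ξ}

lemma IsRegular.mem_closedCube {x : E d} (h : Ξ.IsRegular x) : x ∈ closedCube d :=
  fun m => (h m).1

lemma tendsto_coord {x : E d} (m : Fin d) :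
    Tendsto (fun y : E d => y m) (𝓝[closedCube d] x) (𝓝[Icc 0 1] (x m)) :=
  ContinuousWithinAt.tendsto_nhdsWithin (by fun_prop) fun _ hy => hy m

lemma IsRegular.eventually {x : E d} (h : Ξ.IsRegular x) :
    ∀ᶠ y in 𝓝[closedCube d] x, Ξ.IsRegular y :=
  eventually_all.2 fun m => (tendsto_coord m).eventually (h m).eventually

lemma IsRegular.hasFDerivWithinAt_basisFun {x : E d} (h : Ξ.IsRegular x) (J : Ξ.Index) :
    HasFDerivWithinAt (Ξ.basisFun J)
      (∑ m, Ξ.basisPartial J m x • (EuclideanSpace.proj m : E d →L[ℝ] ℝ)) (closedCube d) x := by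
  have hm : ∀ m ∈ Finset.univ, HasFDerivWithinAt
      (fun y : E d => bspline (Ξ m).knot k (J m) (y m))
      (bsplineDeriv (Ξ m).knot k (J m) (x m) • (EuclideanSpace.proj m : E d →L[ℝ] ℝ))
      (closedCube d) x := fun m _ =>
    ((h m).hasDerivWithinAt k (J m)).comp_hasFDerivWithinAt x
      (EuclideanSpace.proj m : E d →L[ℝ] ℝ).hasFDerivWithinAt fun _ hy => hy m
  refine (HasFDerivWithinAt.finsetProd hm).congr_fderiv ?_
  refine Finset.sum_congr rfl fun m _ => ?_
  rw [smul_smul]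
  congr 1
  rw [basisPartial, ← Finset.mul_prod_erase _ _ (Finset.mem_univ m), if_pos rfl, mul_comm]
  congr 1
  exact Finset.prod_congr rfl fun m' hm' => (if_neg (Finset.ne_of_mem_erase hm')).symm

lemma IsRegular.hasFDerivWithinAt_spline {x : E d} (h : Ξ.IsRegular x) (c : Ξ.Index → F) :
    HasFDerivWithinAt (Ξ.spline c) (Ξ.splineDeriv c x) (closedCube d) x := by
  have := HasFDerivWithinAt.fun_sum (u := Finset.univ)
    fun J _ => (h.hasFDerivWithinAt_basisFun J).smul_const (c J)
  refine this.congr_fderiv ?_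
  ext v
  rw [splineDeriv_apply]
  simp only [_root_.sum_apply, ContinuousLinearMap.smulRight_apply,
    _root_.smul_apply, splinePartial, Finset.sum_smul,
    Finset.smul_sum, smul_smul, smul_eq_mul]
  rw [Finset.sum_comm]
  exact Finset.sum_congr rfl fun _ _ => Finset.sum_congr rfl fun _ _ => by
    rw [mul_comm]; rfl

lemma IsRegular.continuousWithinAt_splineDeriv {x : E d} (h : Ξ.IsRegular x) (c : Ξ.Index → F) :
    ContinuousWithinAt (Ξ.splineDeriv c) (closedCube d) x := by
  have hP : ∀ J m, ContinuousWithinAt (Ξ.basisPartial J m) (closedCube d) x := by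
    intro J m
    refine tendsto_finsetProd _ fun m' _ => ?_
    split_ifs
    · exact ((h m').continuousWithinAt_bsplineDeriv k (J m')).tendsto.comp (tendsto_coord m')
    · exact ((h m').hasDerivWithinAt k (J m')).continuousWithinAt.tendsto.comp (tendsto_coord m')
  refine tendsto_finsetSum _ fun m _ => ?_
  have h1 : ContinuousWithinAt (Ξ.splinePartial c m) (closedCube d) x :=
    tendsto_finsetSum _ fun J _ => (hP J m).smul_const (c J)
  exact ((ContinuousLinearMap.smulRightL ℝ (E d) F
    (EuclideanSpace.proj m : E d →L[ℝ] ℝ)).continuous.tendsto _).comp h1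

lemma measurable_basisFun (J : Ξ.Index) : Measurable (Ξ.basisFun J) :=
  Finset.measurable_fun_prod _ fun m _ => (measurable_bspline _ _ _).comp (by fun_prop)

lemma measurable_basisPartial (J : Ξ.Index) (m : Fin d) : Measurable (Ξ.basisPartial J m) := by
  refine Finset.measurable_fun_prod _ fun m' _ => ?_
  split_ifs
  · exact (measurable_bsplineDeriv _ _ _).comp (by fun_prop)
  · exact (measurable_bspline _ _ _).comp (by fun_prop)

lemma measurable_spline (c : Ξ.Index → ℝ) : Measurable (Ξ.spline c) :=
  Finset.measurable_fun_sum _ fun J _ => (measurable_basisFun J).mul_const _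

lemma measurable_splinePartial (c : Ξ.Index → ℝ) (m : Fin d) :
    Measurable (Ξ.splinePartial c m) :=
  Finset.measurable_fun_sum _ fun J _ => (measurable_basisPartial J m).mul_const _

lemma exists_forall_abs_prod_le {f : Fin d → ℝ → ℝ}
    (hf : ∀ m, ∃ M, ∀ t ∈ Icc (0 : ℝ) 1, |f m t| ≤ M) :
    ∃ M, ∀ x ∈ closedCube d, |∏ m, f m (x m)| ≤ M := by
  choose M hM using hf
  refine ⟨∏ m, M m, fun x hx => ?_⟩
  rw [Finset.abs_prod]
  exact Finset.prod_le_prod (fun _ _ => abs_nonneg _) fun m _ => hM m _ (hx m)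

lemma exists_forall_norm_sum_smul_le {ι : Type*} [Fintype ι] {X : Type*} {s : Set X}
    {b : ι → X → ℝ} (hb : ∀ J, ∃ M, ∀ x ∈ s, |b J x| ≤ M) (c : ι → F) :
    ∃ M, ∀ x ∈ s, ‖∑ J, b J x • c J‖ ≤ M := by
  choose M hM using hb
  refine ⟨∑ J, M J * ‖c J‖, fun x hx => (norm_sum_le _ _).trans ?_⟩
  refine Finset.sum_le_sum fun J _ => ?_
  rw [norm_smul]
  exact mul_le_mul_of_nonneg_right (hM J x hx) (norm_nonneg _)

lemma exists_forall_norm_spline_le (c : Ξ.Index → F) :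
    ∃ M, ∀ x ∈ closedCube d, ‖Ξ.spline c x‖ ≤ M :=
  exists_forall_norm_sum_smul_le (fun _ => exists_forall_abs_prod_le fun _ =>
    exists_forall_abs_bspline_le _ _ _) c

lemma exists_forall_abs_basisPartial_le (J : Ξ.Index) (m : Fin d) :
    ∃ M, ∀ x ∈ closedCube d, |Ξ.basisPartial J m x| ≤ M := by
  refine exists_forall_abs_prod_le
    (f := fun m' t => if m' = m then bsplineDeriv (Ξ m').knot k (J m') t
      else bspline (Ξ m').knot k (J m') t) fun m' => ?_
  by_cases h : m' = m
  · simpa only [if_pos h] using exists_forall_abs_bsplineDeriv_le _ _ _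
  · simpa only [if_neg h] using exists_forall_abs_bspline_le _ _ _

lemma exists_forall_norm_splinePartial_le (c : Ξ.Index → F) (m : Fin d) :
    ∃ M, ∀ x ∈ closedCube d, ‖Ξ.splinePartial c m x‖ ≤ M :=
  exists_forall_norm_sum_smul_le (fun J => exists_forall_abs_basisPartial_le J m) c

/-! ### Continuous splines are Lipschitz continuous -/

/-- Along a coordinate line a spline has a bounded derivative from the right, at the knots too. -/
lemma hasDerivWithinAt_Ici_spline (c : Ξ.Index → F) (x : E d) (m : Fin d) {t : ℝ}
    (ht : t ∈ Ico (0 : ℝ) 1) :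
    HasDerivWithinAt (fun r => Ξ.spline c (WithLp.toLp 2 (Function.update x m r)))
      (Ξ.splinePartial c m (WithLp.toLp 2 (Function.update x m t))) (Ici t) t := by
  refine HasDerivWithinAt.fun_sum fun J _ => HasDerivWithinAt.smul_const ?_ (c J)
  have h1 := (KnotVector.hasDerivWithinAt_Ici_bspline (κ := Ξ m) ht k (J m)).mul_const
    (∏ m' ∈ Finset.univ.erase m, bspline (Ξ m').knot k (J m') (x m'))
  refine (h1.congr_of_mem ?_ self_mem_Ici).congr_deriv ?_
  · intro r _
    rw [basisFun, ← Finset.mul_prod_erase _ _ (Finset.mem_univ m)]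
    simp only [Function.update_self]
    congr 1
    exact Finset.prod_congr rfl fun m' hm' => by
      rw [Function.update_of_ne (Finset.ne_of_mem_erase hm')]
  · rw [basisPartial, ← Finset.mul_prod_erase _ _ (Finset.mem_univ m), if_pos rfl]
    simp only [Function.update_self]
    congr 1
    exact Finset.prod_congr rfl fun m' hm' => by
      rw [if_neg (Finset.ne_of_mem_erase hm'), Function.update_of_ne (Finset.ne_of_mem_erase hm')]

/-- A function that is Lipschitz in each coordinate is Lipschitz on the cube. -/
lemma lipschitzOnWith_of_coord {X : Type*} [NormedAddCommGroup X] {f : E d → X} {M : ℝ} (hM : 0 ≤ M)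
    (h : ∀ x ∈ closedCube d, ∀ m, ∀ t ∈ Icc (0 : ℝ) 1,
      ‖f (WithLp.toLp 2 (Function.update x m t)) - f x‖ ≤ M * |t - x m|) :
    LipschitzOnWith (Real.toNNReal (d * M)) f (closedCube d) := by
  classical
  refine LipschitzOnWith.of_dist_le_mul fun y hy x hx => ?_
  rw [Real.coe_toNNReal _ (by positivity), dist_eq_norm]
  -- The coordinates in `S` have already been moved from `x` to `y`.
  have key : ∀ S : Finset (Fin d),
      ‖f (WithLp.toLp 2 (S.piecewise y x)) - f x‖ ≤ ∑ m ∈ S, M * |y m - x m| := by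
    intro S
    induction S using Finset.induction_on with
    | empty => simp
    | insert m S hm ih =>
      rw [Finset.sum_insert hm, Finset.piecewise_insert]
      refine (norm_sub_le_norm_sub_add_norm_sub _ (f (WithLp.toLp 2 (S.piecewise y x))) _).trans
        (add_le_add ?_ ih)
      have := h (WithLp.toLp 2 (S.piecewise y x)) (fun m' => by
        by_cases hS : m' ∈ S
        · simpa [hS] using hy m'
        · simpa [hS] using hx m') m (y m) (hy m)
      simpa [hm] using this
  have := key Finset.univ
  simp only [Finset.piecewise_univ] at this
  refine this.trans ?_
  calc ∑ m, M * |y m - x m| ≤ ∑ _m : Fin d, M * dist y x := by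
        gcongr with m
        rw [dist_eq_norm]
        exact PiLp.norm_apply_le (y - x) m
    _ = d * M * dist y x := by simp [mul_assoc]

lemma exists_lipschitzOnWith_spline (c : Ξ.Index → F) {f : E d → F}
    (hf : ∀ x ∈ closedCube d, f x = Ξ.spline c x) (hcont : ContinuousOn f (closedCube d)) :
    ∃ L, LipschitzOnWith L f (closedCube d) := by
  choose M hM using fun m => exists_forall_norm_splinePartial_le c m
  have hM0 : ∀ m, 0 ≤ M m := fun m => by
    obtain ⟨x, hx⟩ := openCube_nonempty d
    exact (norm_nonneg _).trans (hM m x (openCube_subset_closedCube d hx))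
  have hle : ∀ m, M m ≤ ∑ m, M m := fun m =>
    Finset.single_le_sum (fun m _ => hM0 m) (Finset.mem_univ m)
  have hupd : ∀ x ∈ closedCube d, ∀ m, ∀ t ∈ Icc (0 : ℝ) 1,
      WithLp.toLp 2 (Function.update x m t) ∈ closedCube d := by
    intro x hx m t ht m'
    by_cases h : m' = m
    · subst h; simpa using ht
    · simpa [h] using hx m'
  have hmono : ∀ x ∈ closedCube d, ∀ m, ∀ a ∈ Icc (0 : ℝ) 1, ∀ b ∈ Icc (0 : ℝ) 1, a ≤ b →
      ‖f (WithLp.toLp 2 (Function.update x m b)) - f (WithLp.toLp 2 (Function.update x m a))‖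
        ≤ (∑ m, M m) * (b - a) := by
    intro x hx m a ha b hb hab
    refine norm_image_sub_le_of_norm_deriv_right_le_segment
      (f := fun t => f (WithLp.toLp 2 (Function.update x m t)))
      (f' := fun t => Ξ.splinePartial c m (WithLp.toLp 2 (Function.update x m t))) ?_ ?_ ?_ b
      ⟨hab, le_rfl⟩
    · refine hcont.comp (Continuous.continuousOn ?_) fun t ht =>
        hupd x hx m t ⟨ha.1.trans ht.1, ht.2.trans hb.2⟩
      exact (PiLp.continuous_toLp 2 _).comp (continuous_const.update m continuous_id)
    · intro t ht
      have ht' : t ∈ Ico (0 : ℝ) 1 := ⟨ha.1.trans ht.1, ht.2.trans_le hb.2⟩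
      refine (hasDerivWithinAt_Ici_spline c x m ht').congr_of_eventuallyEq ?_
        (hf _ (hupd x hx m t (Ico_subset_Icc_self ht')))
      filter_upwards [self_mem_nhdsWithin, mem_nhdsWithin_of_mem_nhds (Iio_mem_nhds ht'.2)]
        with r hr hr'
      exact hf _ (hupd x hx m r ⟨ht'.1.trans hr, le_of_lt hr'⟩)
    · intro t ht
      exact (hM m _ (hupd x hx m t ⟨ha.1.trans ht.1, ht.2.le.trans hb.2⟩)).trans (hle m)
  refine ⟨_, lipschitzOnWith_of_coord (M := ∑ m, M m)
    (Finset.sum_nonneg fun m _ => hM0 m) fun x hx m t ht => ?_⟩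
  have hx' : f x = f (WithLp.toLp 2 (Function.update x m (x m))) := by
    rw [Function.update_eq_self]
  rw [hx']
  rcases le_total (x m) t with hle | hle
  · rw [abs_of_nonneg (sub_nonneg.2 hle)]
    exact hmono x hx m _ (hx m) _ ht hle
  · rw [norm_sub_rev, abs_sub_comm, abs_of_nonneg (sub_nonneg.2 hle)]
    exact hmono x hx m _ ht _ (hx m) hle

end Knots

/-! ### Facets of the cube -/

lemma ae_coord_ne {d : ℕ} (m : Fin d) (a : ℝ) : ∀ᵐ x : E d, x m ≠ a :=
  (PiLp.volume_preserving_ofLp (Fin d)).quasiMeasurePreserving.ae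
    (Measure.ae_eval_ne (μ := fun _ : Fin d => (volume : Measure ℝ)) m a)

/-- The point with `m`-th coordinate `a` and remaining coordinates `y`. -/
def facetMap {n : ℕ} (m : Fin (n + 1)) (a : ℝ) (y : E n) : E (n + 1) :=
  WithLp.toLp 2 (m.insertNth a y)

section facetMap

variable {n : ℕ} (m : Fin (n + 1))

@[simp] lemma facetMap_same (a : ℝ) (y : E n) : facetMap m a y m = a := by simp [facetMap]

@[simp] lemma facetMap_succAbove (a : ℝ) (y : E n) (j : Fin n) :
    facetMap m a y (m.succAbove j) = y j := by simp [facetMap]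

lemma facetMap_mem_closedCube {a : ℝ} (ha : a ∈ Icc (0 : ℝ) 1) {y : E n} (hy : y ∈ closedCube n) :
    facetMap m a y ∈ closedCube (n + 1) := by
  intro m'
  rcases Fin.eq_self_or_eq_succAbove m m' with rfl | ⟨j, rfl⟩
  · simpa using ha
  · simpa using hy j

lemma isometry_facetMap (a : ℝ) : Isometry (facetMap (n := n) m a) := by
  refine Isometry.of_dist_eq fun y z => ?_
  rw [EuclideanSpace.dist_eq, EuclideanSpace.dist_eq, Fin.sum_univ_succAbove _ m]
  simp

/-- Every boundary point of the cube lies on one of the facets. -/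
lemma exists_facetMap_eq {x : E (n + 1)} (hx : x ∈ closedCube (n + 1))
    (hx' : x ∉ openCube (n + 1)) :
    ∃ m, ∃ a : ℝ, (a = 0 ∨ a = 1) ∧ ∃ y ∈ closedCube n, facetMap m a y = x := by
  simp only [openCube, mem_ofPred_eq, not_forall] at hx'
  obtain ⟨m, hm⟩ := hx'
  refine ⟨m, x m, ?_, WithLp.toLp 2 (fun j => x (m.succAbove j)), fun j => hx _, ?_⟩
  · by_contra! h
    exact hm ⟨(hx m).1.lt_of_ne' h.1, (hx m).2.lt_of_ne h.2⟩
  · ext m'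
    rcases Fin.eq_self_or_eq_succAbove m m' with rfl | ⟨j, rfl⟩ <;> simp

lemma measurePreserving_facetMap :
    MeasurePreserving (fun p : ℝ × E n => facetMap m p.1 p.2) := by
  have h1 : MeasurePreserving (Prod.map id (WithLp.ofLp (p := 2)) : ℝ × E n → ℝ × (Fin n → ℝ)) :=
    (MeasurePreserving.id volume).prod (PiLp.volume_preserving_ofLp (Fin n))
  have h2 := (volume_preserving_piFinSuccAbove (fun _ : Fin (n + 1) => ℝ) m).symm
  exact ((PiLp.volume_preserving_toLp (Fin (n + 1))).comp h2).comp h1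

lemma lintegral_facetMap_le {f : E (n + 1) → ENNReal} (hf : Measurable f) :
    ∫⁻ y in closedCube n, ∫⁻ t in Ioo (0 : ℝ) 1, f (facetMap m t y)
      ≤ ∫⁻ x in closedCube (n + 1), f x := by
  have hφ := measurePreserving_facetMap m
  have hcube : MeasurableSet (closedCube (n + 1)) := (isClosed_closedCube _).measurableSet
  rw [← hφ.setLIntegral_comp_preimage hcube hf]
  have hsub : Ioo (0 : ℝ) 1 ×ˢ closedCube n
      ⊆ (fun p : ℝ × E n => facetMap m p.1 p.2) ⁻¹' closedCube (n + 1) :=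
    fun p hp => facetMap_mem_closedCube m (Ioo_subset_Icc_self hp.1) hp.2
  refine le_trans (le_of_eq ?_) (lintegral_mono_set hsub)
  rw [Measure.volume_eq_prod, ← Measure.prod_restrict]
  exact (lintegral_prod_symm _ (hf.comp hφ.measurable).aemeasurable).symm

end facetMap

namespace Knots

variable {d k : ℕ} {Ξ : Knots d k}

/-! ### Mesh size -/

lemma exists_isElement (Ξ : Knots d k) : ∃ e, Ξ.IsElement e := by
  choose e he using fun m => KnotVector.exists_mem_knotSpan (κ := Ξ m) (t := 0) (by simp)
  exact ⟨e, fun m => (he m).1⟩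

lemma element_subset_closedCube (Ξ : Knots d k) (e : Fin d → ℕ) : Ξ.element e ⊆ closedCube d :=
  fun _ hx m => ⟨((Ξ m).knot_nonneg _).trans (hx m).1, (hx m).2.trans ((Ξ m).knot_le_one _)⟩

lemma edge_le_diam {e : Fin d → ℕ} (he : Ξ.IsElement e) (m : Fin d) :
    (Ξ m).knot (e m + 1) - (Ξ m).knot (e m) ≤ Metric.diam (Ξ.element e) := by
  let x : E d := WithLp.toLp 2 fun m => (Ξ m).knot (e m)
  let y : E d := WithLp.toLp 2 fun m => (Ξ m).knot (e m + 1)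
  have hx : x ∈ Ξ.element e := fun m => ⟨le_rfl, (he m).le⟩
  have hy : y ∈ Ξ.element e := fun m => ⟨(he m).le, le_rfl⟩
  have hb := (isCompact_closedCube d).isBounded.subset (Ξ.element_subset_closedCube e)
  refine le_trans ?_ (Metric.dist_le_diam_of_mem hb hy hx)
  rw [dist_eq_norm]
  exact (le_abs_self _).trans (PiLp.norm_apply_le (y - x) m)

lemma diam_le_meshSize {e : Fin d → ℕ} (he : Ξ.IsElement e) :
    Metric.diam (Ξ.element e) ≤ Ξ.meshSize := by
  refine le_csSup ⟨Metric.diam (closedCube d), ?_⟩ ⟨e, he, rfl⟩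
  rintro _ ⟨e, -, rfl⟩
  exact Metric.diam_mono (Ξ.element_subset_closedCube e) (isCompact_closedCube d).isBounded

lemma meshSize_pos (m : Fin d) (Ξ : Knots d k) : 0 < Ξ.meshSize := by
  obtain ⟨e, he⟩ := Ξ.exists_isElement
  exact (sub_pos.2 (he m)).trans_le ((edge_le_diam he m).trans (diam_le_meshSize he))

/-- In a quasi-uniform mesh every nonempty knot span is comparable to the mesh size. -/
lemma QuasiUniform.meshSize_le {θ : ℝ} (h : Ξ.QuasiUniform θ) (m : Fin d) {e : ℕ}
    (he : (Ξ m).knot e < (Ξ m).knot (e + 1)) :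
    Ξ.meshSize ≤ θ ^ 2 * ((Ξ m).knot (e + 1) - (Ξ m).knot e) := by
  obtain ⟨e', he'⟩ := Ξ.exists_isElement
  have hel : Ξ.IsElement (Function.update e' m e) := by
    intro m'
    by_cases hm : m' = m
    · subst hm; simpa using he
    · simpa [hm] using he' m'
  obtain ⟨h1, h2⟩ := h _ hel
  have h3 := h2 m
  rw [Function.update_self] at h3
  have hpos := meshSize_pos m Ξ
  have hθ : 0 ≤ θ := by
    by_contra! hneg
    have := mul_nonpos_of_nonpos_of_nonneg hneg.le
      (Metric.diam_nonneg (s := Ξ.element (Function.update e' m e)))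
    linarith
  calc Ξ.meshSize ≤ θ * Metric.diam (Ξ.element (Function.update e' m e)) := h1
    _ ≤ θ * (θ * ((Ξ m).knot (e + 1) - (Ξ m).knot e)) := by gcongr
    _ = _ := by ring

/-! ### Regular points -/

lemma isRegular_of_forall {x : E d} (hx : x ∈ closedCube d)
    (h : ∀ m, x m = 0 ∨ x m = 1 ∨ ∀ j, x m ≠ (Ξ m).knot j) : Ξ.IsRegular x :=
  fun m => KnotVector.isRegularPoint_of_forall_ne (hx m) (h m)

lemma ae_forall_ne_knot (Ξ : Knots d k) : ∀ᵐ x : E d, ∀ m j, x m ≠ (Ξ m).knot j :=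
  ae_all_iff.2 fun m => ae_all_iff.2 fun _ => ae_coord_ne m _

/-- The union of the open micro-elements: the points of the cube off all knot hyperplanes. The
boundary of the cube is excluded too, as `0` and `1` are knots. -/
def openElements (Ξ : Knots d k) : Set (E d) := {x ∈ closedCube d | ∀ m j, x m ≠ (Ξ m).knot j}

lemma measurableSet_openElements (Ξ : Knots d k) : MeasurableSet Ξ.openElements := by
  have : Ξ.openElements = closedCube d ∩ ⋂ m, ⋂ j, {x : E d | x m = (Ξ m).knot j}ᶜ := by
    ext x; simp [openElements]
  rw [this]
  refine (isClosed_closedCube d).measurableSet.inter ?_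
  refine MeasurableSet.iInter fun m => MeasurableSet.iInter fun j => MeasurableSet.compl ?_
  exact measurableSet_eq_fun (by fun_prop) measurable_const

lemma openElements_subset_openCube (Ξ : Knots d k) : Ξ.openElements ⊆ openCube d := fun _ hx m =>
  ⟨(hx.1 m).1.lt_of_ne' ((Ξ m).knot_left 0 (Nat.zero_le _) ▸ hx.2 m 0),
    (hx.1 m).2.lt_of_ne ((Ξ m).knot_right _ le_rfl ▸ hx.2 m (Ξ m).n)⟩

lemma isRegular_of_mem_openElements {x : E d} (hx : x ∈ Ξ.openElements) : Ξ.IsRegular x :=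
  isRegular_of_forall hx.1 fun m => Or.inr (Or.inr (hx.2 m))

lemma openElements_ae_eq_closedCube (Ξ : Knots d k) :
    Ξ.openElements =ᵐ[volume] closedCube d := by
  filter_upwards [Ξ.ae_forall_ne_knot] with x hx
  exact propext ⟨fun h => h.1, fun h => ⟨h, hx⟩⟩

/-- Almost every point of a facet of the cube is regular. -/
lemma ae_isRegular_facetMap {n : ℕ} (Ξ : Knots (n + 1) k) (m : Fin (n + 1)) {a : ℝ}
    (ha : a = 0 ∨ a = 1) : ∀ᵐ y : E n, y ∈ closedCube n → Ξ.IsRegular (facetMap m a y) := by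
  have h : ∀ᵐ y : E n, ∀ i j, y i ≠ (Ξ (m.succAbove i)).knot j :=
    ae_all_iff.2 fun i => ae_all_iff.2 fun _ => ae_coord_ne i _
  filter_upwards [h] with y hy hy'
  refine isRegular_of_forall (facetMap_mem_closedCube m (by rcases ha with rfl | rfl <;> simp) hy')
    fun m' => ?_
  rcases Fin.eq_self_or_eq_succAbove m m' with rfl | ⟨j, rfl⟩
  · rw [facetMap_same]; tauto
  · rw [facetMap_succAbove]; exact Or.inr (Or.inr (hy j))

/-! ### The inverse trace inequality on the parametric domain -/

/-- The squared length of the gradient of the scalar spline with coefficients `c`. -/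
def gradSq (Ξ : Knots d k) (c : Ξ.Index → ℝ) (x : E d) : ℝ := ∑ m, Ξ.splinePartial c m x ^ 2

lemma gradSq_nonneg (c : Ξ.Index → ℝ) (x : E d) : 0 ≤ Ξ.gradSq c x :=
  Finset.sum_nonneg fun _ _ => sq_nonneg _

lemma measurable_gradSq (c : Ξ.Index → ℝ) : Measurable (Ξ.gradSq c) :=
  Finset.measurable_fun_sum _ fun m _ => (measurable_splinePartial c m).pow_const 2

lemma exists_forall_gradSq_le (c : Ξ.Index → ℝ) :
    ∃ M, ∀ x ∈ closedCube d, Ξ.gradSq c x ≤ M := by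
  choose M hM using fun m => exists_forall_norm_splinePartial_le c m
  exact ⟨∑ m, M m ^ 2, fun x hx => Finset.sum_le_sum fun m _ => by
    rw [← sq_abs]; exact pow_le_pow_left₀ (abs_nonneg _) (hM m x hx) 2⟩

lemma norm_splineDeriv_sq (c : Ξ.Index → ℝ) (x : E d) :
    ‖Ξ.splineDeriv c x‖ ^ 2 = Ξ.gradSq c x := by
  let g : E d := WithLp.toLp 2 fun m => Ξ.splinePartial c m x
  have h : Ξ.splineDeriv c x = InnerProductSpace.toDual ℝ (E d) g := by
    ext v
    rw [splineDeriv_apply, InnerProductSpace.toDual_apply_apply, PiLp.inner_apply]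
    exact Finset.sum_congr rfl fun m _ => by simp [g]
  rw [h, LinearIsometryEquiv.norm_map, EuclideanSpace.real_norm_sq_eq]
  rfl

/-- On a line in direction `m₀`, within a knot span, the partial derivatives of a spline are
polynomials of degree at most `k`. -/
lemma exists_polynomial_splinePartial {n : ℕ} {Ξ : Knots (n + 1) k} (c : Ξ.Index → ℝ)
    (m m₀ : Fin (n + 1)) (y : E n) {e : ℕ} (he : (Ξ m₀).knot e < (Ξ m₀).knot (e + 1)) :
    ∃ P : Polynomial ℝ, P.natDegree ≤ k ∧ ∀ t ∈ knotSpan (Ξ m₀).knot e,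
      Ξ.splinePartial c m (facetMap m₀ t y) = P.eval t := by
  have hJ : ∀ J : Ξ.Index, ∃ P : Polynomial ℝ, P.natDegree ≤ k ∧
      ∀ t ∈ knotSpan (Ξ m₀).knot e, (if m₀ = m then bsplineDeriv (Ξ m₀).knot k (J m₀) t
        else bspline (Ξ m₀).knot k (J m₀) t) = P.eval t := by
    intro J
    obtain ⟨P, Q, hP, hQ, h⟩ := exists_polynomial_bspline he k (J m₀)
    by_cases hm : m₀ = m
    · simp only [if_pos hm]
      exact ⟨Q, hQ, fun t ht => (h t ht).2⟩
    · simp only [if_neg hm]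
      exact ⟨P, hP, fun t ht => (h t ht).1⟩
  choose P hP h using hJ
  let r : Ξ.Index → ℝ := fun J => ∏ i : Fin n,
    if m₀.succAbove i = m then
      bsplineDeriv (Ξ (m₀.succAbove i)).knot k (J (m₀.succAbove i)) (y i)
    else bspline (Ξ (m₀.succAbove i)).knot k (J (m₀.succAbove i)) (y i)
  refine ⟨∑ J, Polynomial.C (r J * c J) * P J, Polynomial.natDegree_sum_le_of_forall_le _ _
    fun J _ => (Polynomial.natDegree_C_mul_le _ _).trans (hP J), fun t ht => ?_⟩
  rw [Polynomial.eval_finsetSum, splinePartial]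
  refine Finset.sum_congr rfl fun J _ => ?_
  rw [Polynomial.eval_mul, Polynomial.eval_C, ← h J t ht, basisPartial,
    Fin.prod_univ_succAbove _ m₀]
  simp only [facetMap_same, facetMap_succAbove, smul_eq_mul]
  change _ * r J * c J = _
  ring

/-- The inverse trace inequality for gradients of splines along a line orthogonal to a facet. -/
lemma exists_trace_le_lintegral_line (k : ℕ) : ∃ C > (0 : ℝ), ∀ (n : ℕ) (Ξ : Knots (n + 1) k)
    (θ : ℝ), Ξ.QuasiUniform θ → ∀ (c : Ξ.Index → ℝ) (m₀ : Fin (n + 1)) (a : ℝ), a = 0 ∨ a = 1 →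
    ∀ y : E n, ENNReal.ofReal (Ξ.meshSize * Ξ.gradSq c (facetMap m₀ a y))
      ≤ ENNReal.ofReal (θ ^ 2 * C) *
        ∫⁻ t in Ioo (0 : ℝ) 1, ENNReal.ofReal (Ξ.gradSq c (facetMap m₀ t y)) := by
  obtain ⟨C, hC, hpoly⟩ := exists_abs_mul_sq_eval_le_lintegral k
  refine ⟨C, hC, fun n Ξ θ hΞ c m₀ a ha y => ?_⟩
  have ha' : a ∈ Icc (0 : ℝ) 1 := by rcases ha with rfl | rfl <;> simp
  obtain ⟨e, he, hae⟩ := KnotVector.exists_mem_knotSpan (κ := Ξ m₀) ha'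
  have h0 := (Ξ m₀).knot_nonneg e
  have h1 := (Ξ m₀).knot_le_one (e + 1)
  -- The knot span next to the facet, from the facet to the opposite end `b`.
  obtain ⟨b, hb, hspan, hsub⟩ : ∃ b, |b - a| = (Ξ m₀).knot (e + 1) - (Ξ m₀).knot e ∧
      uIoo a b ⊆ knotSpan (Ξ m₀).knot e ∧ uIoo a b ⊆ Ioo 0 1 := by
    rcases ha with rfl | rfl
    · have h0' : (Ξ m₀).knot e = 0 := le_antisymm hae.1 h0
      refine ⟨(Ξ m₀).knot (e + 1), ?_, ?_, ?_⟩
      · rw [h0', abs_of_nonneg]; linarith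
      · rw [uIoo_of_lt (h0' ▸ he)]
        exact fun t ht => ⟨h0'.trans_le ht.1.le, ht.2.le, Or.inl ht.2⟩
      · rw [uIoo_of_lt (h0' ▸ he)]
        exact Ioo_subset_Ioo_right h1
    · have h1' : (Ξ m₀).knot (e + 1) = 1 := le_antisymm h1 hae.2.1
      refine ⟨(Ξ m₀).knot e, ?_, ?_, ?_⟩
      · rw [h1', abs_sub_comm, abs_of_nonneg]; linarith
      · rw [uIoo_of_gt (h1' ▸ he)]
        exact fun t ht => ⟨ht.1.le, ht.2.le.trans h1'.ge, Or.inl (h1'.symm ▸ ht.2)⟩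
      · rw [uIoo_of_gt (h1' ▸ he)]
        exact Ioo_subset_Ioo_left h0
  have hmesh : Ξ.meshSize ≤ θ ^ 2 * |b - a| := hb ▸ hΞ.meshSize_le m₀ he
  have hline : ∀ m, ENNReal.ofReal (|b - a| * Ξ.splinePartial c m (facetMap m₀ a y) ^ 2)
      ≤ ENNReal.ofReal C *
        ∫⁻ t in Ioo (0 : ℝ) 1, ENNReal.ofReal (Ξ.splinePartial c m (facetMap m₀ t y) ^ 2) := by
    intro m
    obtain ⟨P, hP, h⟩ := exists_polynomial_splinePartial c m m₀ y he
    rw [h a hae]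
    refine (hpoly P hP a b).trans ?_
    gcongr ENNReal.ofReal C * ?_
    refine le_trans (le_of_eq ?_) (lintegral_mono_set hsub)
    exact setLIntegral_congr_fun measurableSet_Ioo fun t ht => by rw [h t (hspan ht)]
  have hmeas : ∀ m, Measurable fun t : ℝ =>
      ENNReal.ofReal (Ξ.splinePartial c m (facetMap m₀ t y) ^ 2) := fun m =>
    (((measurable_splinePartial c m).comp ((measurePreserving_facetMap m₀).measurable.comp
      (measurable_id.prodMk measurable_const))).pow_const 2).ennreal_ofReal
  have hsum : ∀ t, ENNReal.ofReal (Ξ.gradSq c (facetMap m₀ t y))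
      = ∑ m, ENNReal.ofReal (Ξ.splinePartial c m (facetMap m₀ t y) ^ 2) := fun t =>
    ENNReal.ofReal_sum_of_nonneg fun _ _ => sq_nonneg _
  simp only [hsum]
  rw [lintegral_finsetSum _ fun m _ => hmeas m, ENNReal.ofReal_mul (sq_nonneg θ), mul_assoc,
    Finset.mul_sum]
  calc ENNReal.ofReal (Ξ.meshSize * Ξ.gradSq c (facetMap m₀ a y))
      ≤ ENNReal.ofReal (θ ^ 2 * ∑ m, |b - a| * Ξ.splinePartial c m (facetMap m₀ a y) ^ 2) := by
        refine ENNReal.ofReal_le_ofReal ?_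
        rw [← Finset.mul_sum, ← mul_assoc]
        exact mul_le_mul_of_nonneg_right hmesh (gradSq_nonneg c _)
    _ = ENNReal.ofReal (θ ^ 2) *
          ∑ m, ENNReal.ofReal (|b - a| * Ξ.splinePartial c m (facetMap m₀ a y) ^ 2) := by
        rw [ENNReal.ofReal_mul (sq_nonneg θ),
          ENNReal.ofReal_sum_of_nonneg fun _ _ => by positivity]
    _ ≤ _ := by gcongr with m; exact hline m

/-- The inverse trace inequality for gradients of splines on a facet of the cube. -/
lemma exists_lintegral_facet_le (k : ℕ) : ∃ C > (0 : ℝ), ∀ (n : ℕ) (Ξ : Knots (n + 1) k)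
    (θ : ℝ), Ξ.QuasiUniform θ → ∀ (c : Ξ.Index → ℝ) (m₀ : Fin (n + 1)) (a : ℝ), a = 0 ∨ a = 1 →
    ENNReal.ofReal Ξ.meshSize * ∫⁻ y in closedCube n, ENNReal.ofReal (Ξ.gradSq c (facetMap m₀ a y))
      ≤ ENNReal.ofReal (θ ^ 2 * C) *
        ∫⁻ x in closedCube (n + 1), ENNReal.ofReal (Ξ.gradSq c x) := by
  obtain ⟨C, hC, h⟩ := exists_trace_le_lintegral_line k
  refine ⟨C, hC, fun n Ξ θ hΞ c m₀ a ha => ?_⟩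
  rw [← lintegral_const_mul' _ _ ENNReal.ofReal_ne_top]
  simp only [← ENNReal.ofReal_mul (meshSize_pos m₀ Ξ).le]
  refine (lintegral_mono fun y => h n Ξ θ hΞ c m₀ a ha y).trans ?_
  rw [lintegral_const_mul' _ _ ENNReal.ofReal_ne_top]
  gcongr
  exact lintegral_facetMap_le m₀ (measurable_gradSq c).ennreal_ofReal

end Knots

/-! ### Invertible linear maps and Lipschitz images -/

/-- Linear maps with bounded norm and with determinant bounded away from zero have uniformly bounded
inverses. -/
lemma exists_mul_norm_le_norm_apply (d : ℕ) (L : ℝ) {cm : ℝ} (hcm : 0 < cm) :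
    ∃ c > (0 : ℝ), ∀ A : E d →L[ℝ] E d, ‖A‖ ≤ L → cm ≤ |A.det| → ∀ v, c * ‖v‖ ≤ ‖A v‖ := by
  let S : Set ((E d →L[ℝ] E d) × E d) :=
    (Metric.closedBall 0 L ∩ {A | cm ≤ |A.det|}) ×ˢ Metric.sphere 0 1
  have hS : IsCompact S := by
    refine IsCompact.prod (IsCompact.inter_right (isCompact_closedBall 0 L) ?_) (isCompact_sphere 0 1)
    exact isClosed_le continuous_const ContinuousLinearMap.continuous_det.abs
  have hcont : ContinuousOn (fun p : (E d →L[ℝ] E d) × E d => ‖p.1 p.2‖) S := by fun_prop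
  obtain ⟨c, hc, hle⟩ : ∃ c > (0 : ℝ), ∀ p ∈ S, c ≤ ‖p.1 p.2‖ := by
    rcases S.eq_empty_or_nonempty with hS0 | hS0
    · exact ⟨1, one_pos, by simp [hS0]⟩
    obtain ⟨⟨A, v⟩, hp, hmin⟩ := hS.exists_isMinOn hS0 hcont
    refine ⟨‖A v‖, norm_pos_iff.2 fun h0 => ?_, fun p hp => hmin hp⟩
    have hdet : A.det ≠ 0 := abs_pos.1 (hcm.trans_le hp.1.2)
    have hv : v = 0 := by
      have := (LinearMap.equivOfDetNeZero (A : E d →ₗ[ℝ] E d) hdet).injective.eq_iff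
        (a := v) (b := 0)
      simpa using this.1 (by simpa using h0)
    simpa [hv] using hp.2
  refine ⟨c, hc, fun A hA hdet v => ?_⟩
  rcases eq_or_ne v 0 with rfl | hv
  · simp
  have hv' : 0 < ‖v‖ := norm_pos_iff.2 hv
  have := hle (A, ‖v‖⁻¹ • v) ⟨⟨by simpa using hA, hdet⟩, by simp [norm_smul, hv'.ne']⟩
  rw [map_smul, norm_smul, norm_inv, norm_norm, inv_mul_eq_div, le_div_iff₀ hv'] at this
  exact this

section Lipschitz

variable {n d : ℕ} {f : E n → E d} {Q : Set (E n)} {K : NNReal}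

lemma hausdorffMeasure_lipschitz_image_le (hf : LipschitzOnWith K f Q) :
    (μHE[n] : Measure (E d)) (f '' Q) ≤ (K : ENNReal) ^ n * volume Q := by
  have h := hf.hausdorffMeasure_image_le (d := n) (Nat.cast_nonneg n)
  rw [← EuclideanSpace.euclideanHausdorffMeasure_eq_volume, Measure.euclideanHausdorffMeasure_def,
    Measure.euclideanHausdorffMeasure_def, Measure.smul_apply, Measure.smul_apply,
    ENNReal.smul_def, ENNReal.smul_def, smul_eq_mul, smul_eq_mul, mul_left_comm]
  rw [ENNReal.rpow_natCast] at h
  gcongr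

/-- Integrals over the image of a Lipschitz map are controlled by integrals over its domain. -/
lemma lintegral_lipschitz_image_le (hf : LipschitzOnWith K f Q) (hQ : MeasurableSet Q)
    (g : E d → ENNReal) :
    ∫⁻ x in f '' Q, g x ∂(μHE[n] : Measure (E d)) ≤ (K : ENNReal) ^ n * ∫⁻ y in Q, g (f y) := by
  have hmeas : AEMeasurable f (volume.restrict Q) := hf.continuousOn.aemeasurable hQ
  have hle : (μHE[n] : Measure (E d)).restrict (f '' Q)
      ≤ (K : ENNReal) ^ n • Measure.map f (volume.restrict Q) := by
    refine Measure.le_iff.2 fun B hB => ?_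
    rw [Measure.restrict_apply hB, Measure.smul_apply, Measure.map_apply_of_aemeasurable hmeas hB,
      Measure.restrict_apply₀ (hmeas.nullMeasurable hB), inter_comm B,
      inter_comm (f ⁻¹' B), ← image_inter_preimage]
    exact hausdorffMeasure_lipschitz_image_le (hf.mono inter_subset_left)
  refine (lintegral_mono' hle le_rfl).trans ?_
  rw [lintegral_smul_measure, smul_eq_mul]
  gcongr
  exact lintegral_map_le _ _

lemma ae_mem_lipschitz_image {p : E n → Prop} (hf : LipschitzOnWith K f Q)
    (hp : ∀ᵐ y, y ∈ Q → p y) :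
    ∀ᵐ x ∂(μHE[n] : Measure (E d)), x ∈ f '' Q → ∃ y ∈ Q, p y ∧ f y = x := by
  have h0 : (μHE[n] : Measure (E d)) (f '' {y ∈ Q | ¬ p y}) = 0 := by
    refine le_antisymm ((hausdorffMeasure_lipschitz_image_le (hf.mono (sep_subset _ _))).trans ?_)
      zero_le
    have : volume {y ∈ Q | ¬ p y} = 0 := by
      have := ae_iff.1 hp
      simpa only [Classical.not_imp] using this
    rw [this, mul_zero]
  refine ae_iff.2 (measure_mono_null ?_ h0)
  intro x hx
  simp only [mem_ofPred_eq, Classical.not_imp] at hx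
  obtain ⟨⟨y, hy, rfl⟩, h⟩ := hx
  exact ⟨y, ⟨hy, fun hpy => h ⟨y, hy, hpy, rfl⟩⟩, rfl⟩

end Lipschitz

/-! ### The geometry of a patch -/

namespace Multipatch

variable {d N k : ℕ} (G : Multipatch d N) (i : Fin N)

lemma image_closedCube : G.Φ i '' closedCube d = closure (G.sub i) := by
  apply Subset.antisymm
  · rintro _ ⟨x, hx, rfl⟩
    rw [← G.image_cube i]
    exact ((G.continuousOn i x hx).mono (openCube_subset_closedCube d)).mem_closure_image
      (closedCube_subset_closure_openCube d hx)
  · refine closure_minimal ?_ ((isCompact_closedCube d).image_of_continuousOn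
      (G.continuousOn i)).isClosed
    rw [← G.image_cube i]
    exact image_mono (openCube_subset_closedCube d)

lemma Ψ_Φ {x : E d} (hx : x ∈ closedCube d) : G.Ψ i (G.Φ i x) = x :=
  (G.injOn i).leftInvOn_invFunOn hx

lemma continuousOn_Ψ : ContinuousOn (G.Ψ i) (closure (G.sub i)) := by
  rw [← image_closedCube, continuousOn_iff_isClosed]
  intro C hC
  refine ⟨G.Φ i '' (closedCube d ∩ C),
    (((isCompact_closedCube d).inter_right hC).image_of_continuousOn
      ((G.continuousOn i).mono inter_subset_left)).isClosed, ?_⟩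
  ext x
  constructor
  · rintro ⟨h, y, hy, rfl⟩
    rw [mem_preimage, G.Ψ_Φ i hy] at h
    exact ⟨⟨y, ⟨hy, h⟩, rfl⟩, y, hy, rfl⟩
  · rintro ⟨⟨y, ⟨hy, h⟩, rfl⟩, h'⟩
    refine ⟨?_, h'⟩
    rwa [mem_preimage, G.Ψ_Φ i hy]

lemma exists_of_mem_frontier {x : E d} (hx : x ∈ frontier (G.sub i)) :
    ∃ y ∈ closedCube d, y ∉ openCube d ∧ G.Φ i y = x := by
  rw [(G.isOpen_sub i).frontier_eq, ← image_closedCube, ← image_cube] at hx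
  obtain ⟨⟨y, hy, rfl⟩, h⟩ := hx
  exact ⟨y, hy, fun h' => h ⟨y, h', rfl⟩, rfl⟩

lemma aemeasurable_Ψ {s : Set (E d)} (hs : s ⊆ closure (G.sub i)) (hs' : MeasurableSet s)
    (ν : Measure (E d)) : AEMeasurable (G.Ψ i) (ν.restrict s) :=
  ((G.continuousOn_Ψ i).mono hs).aemeasurable hs'

/-- The parametrizations are Lipschitz continuous, with a constant that depends on the geometry
alone. -/
lemma exists_lipschitzOnWith (h : ∃ Ξ : Fin N → Knots d k, ∀ i, (Ξ i).Represents (G.Φ i)) :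
    ∃ L : NNReal, ∀ i, LipschitzOnWith L (G.Φ i) (closedCube d) := by
  obtain ⟨Ξ, hΞ⟩ := h
  choose c hc using hΞ
  choose L hL using fun i => Knots.exists_lipschitzOnWith_spline (c i) (hc i) (G.continuousOn i)
  exact ⟨∑ i, L i, fun i => (hL i).weaken
    (Finset.single_le_sum (f := L) (fun _ _ => zero_le) (Finset.mem_univ i))⟩

variable {G i} {Ξ : Knots d k}

/-- At a regular point, up to the boundary, the derivative of the parametrization inherits the
bounds that hold in the interior. -/
lemma bounds_splineDeriv {c : Ξ.Index → E d} (hc : ∀ x ∈ closedCube d, G.Φ i x = Ξ.spline c x)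
    {L : NNReal} (hL : LipschitzOnWith L (G.Φ i) (closedCube d)) {cm : ℝ}
    (hcm : ∀ x ∈ openCube d, DifferentiableAt ℝ (G.Φ i) x → cm ≤ |(fderiv ℝ (G.Φ i) x).det|)
    {x : E d} (hx : Ξ.IsRegular x) :
    HasFDerivWithinAt (G.Φ i) (Ξ.splineDeriv c x) (closedCube d) x ∧
      ‖Ξ.splineDeriv c x‖ ≤ L ∧ cm ≤ |(Ξ.splineDeriv c x).det| := by
  have hD : ∀ y, Ξ.IsRegular y →
      HasFDerivWithinAt (G.Φ i) (Ξ.splineDeriv c y) (closedCube d) y := fun y hy =>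
    (hy.hasFDerivWithinAt_spline c).congr hc (hc y hy.mem_closedCube)
  refine ⟨hD x hx, ?_⟩
  have hclosed : IsClosed {A : E d →L[ℝ] E d | ‖A‖ ≤ L ∧ cm ≤ |A.det|} :=
    (isClosed_le continuous_norm continuous_const).inter
      (isClosed_le continuous_const ContinuousLinearMap.continuous_det.abs)
  have hsub := nhdsWithin_mono x (openCube_subset_closedCube d)
  have hne : (𝓝[openCube d] x).NeBot :=
    mem_closure_iff_nhdsWithin_neBot.1 (closedCube_subset_closure_openCube d hx.mem_closedCube)
  have hlim : Tendsto (Ξ.splineDeriv c) (𝓝[openCube d] x) (𝓝 (Ξ.splineDeriv c x)) :=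
    (hx.continuousWithinAt_splineDeriv c).tendsto.mono_left hsub
  refine hclosed.mem_of_tendsto hlim ?_
  filter_upwards [self_mem_nhdsWithin, hsub hx.eventually] with y hy hy'
  have hnhds : closedCube d ∈ 𝓝 y :=
    mem_of_superset ((isOpen_openCube d).mem_nhds hy) (openCube_subset_closedCube d)
  have hDy := (hD y hy').hasFDerivAt hnhds
  refine ⟨hDy.le_of_lipschitzOn hnhds hL, ?_⟩
  rw [← hDy.fderiv]
  exact hcm y hy hDy.differentiableAt

/-- The gradient on a patch is comparable to the gradient in the parametric domain, at the image of
each regular point, up to the boundary. -/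
lemma gradientWithin_bounds {A : E d →L[ℝ] E d} {x : E d} (hx : Ξ.IsRegular x)
    (hA : HasFDerivWithinAt (G.Φ i) A (closedCube d) x) {L c : ℝ} (hAL : ‖A‖ ≤ L) (hc : 0 < c)
    (hAc : ∀ v, c * ‖v‖ ≤ ‖A v‖) (b : Ξ.Index → ℝ) :
    c ^ 2 * ‖gradientWithin (Ξ.spline b ∘ G.Ψ i) (closure (G.sub i)) (G.Φ i x)‖ ^ 2 ≤ Ξ.gradSq b x ∧
      Ξ.gradSq b x
        ≤ L ^ 2 * ‖gradientWithin (Ξ.spline b ∘ G.Ψ i) (closure (G.sub i)) (G.Φ i x)‖ ^ 2 := by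
  have hinj : Function.Injective A := (injective_iff_map_eq_zero A).2 fun v hv => by
    have := hAc v
    rw [hv, norm_zero] at this
    exact norm_le_zero_iff.1 (nonpos_of_mul_nonpos_right this hc)
  let A' : E d ≃L[ℝ] E d :=
    (LinearEquiv.ofInjectiveEndo (A : E d →ₗ[ℝ] E d) hinj).toContinuousLinearEquiv
  have hA' : (A' : E d →L[ℝ] E d) = A := by ext1 v; rfl
  have hxc := hx.mem_closedCube
  have hmem : G.Φ i x ∈ closure (G.sub i) := by
    rw [← image_closedCube]; exact mem_image_of_mem _ hxc
  have hΨx := G.Ψ_Φ i hxc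
  have hΨ : HasFDerivWithinAt (G.Ψ i) (A'.symm : E d →L[ℝ] E d) (closure (G.sub i)) (G.Φ i x) := by
    refine HasFDerivWithinAt.of_local_left_inverse (f := G.Φ i) (t := closedCube d) ?_ ?_ hmem ?_
    · refine ContinuousWithinAt.tendsto_nhdsWithin (G.continuousOn_Ψ i _ hmem) ?_
      rw [← image_closedCube]
      rintro _ ⟨y, hy, rfl⟩
      rwa [G.Ψ_Φ i hy]
    · rw [hΨx, hA']; exact hA
    · filter_upwards [self_mem_nhdsWithin] with y hy
      rw [← image_closedCube] at hy
      obtain ⟨z, hz, rfl⟩ := hy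
      rw [G.Ψ_Φ i hz]
  have huniq : UniqueDiffWithinAt ℝ (closure (G.sub i)) (G.Φ i x) := by
    rw [← image_closedCube]
    refine hA.uniqueDiffWithinAt (uniqueDiffOn_closedCube d x hxc) ?_
    rw [← hA']
    exact A'.surjective.denseRange
  have hspl : HasFDerivWithinAt (Ξ.spline b) (Ξ.splineDeriv b x) (closedCube d)
      (G.Ψ i (G.Φ i x)) := by
    rw [hΨx]; exact hx.hasFDerivWithinAt_spline b
  have hu : HasFDerivWithinAt (Ξ.spline b ∘ G.Ψ i)
      ((Ξ.splineDeriv b x).comp (A'.symm : E d →L[ℝ] E d)) (closure (G.sub i)) (G.Φ i x) := by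
    refine hspl.comp _ hΨ ?_
    rw [← image_closedCube]
    rintro _ ⟨y, hy, rfl⟩
    rwa [G.Ψ_Φ i hy]
  rw [gradientWithin, LinearIsometryEquiv.norm_map, hu.fderivWithin huniq,
    ← Knots.norm_splineDeriv_sq, ← mul_pow, ← mul_pow]
  have hL : 0 ≤ L := (norm_nonneg _).trans hAL
  constructor
  · refine pow_le_pow_left₀ (by positivity) ?_ 2
    rw [← le_div_iff₀' hc]
    refine ContinuousLinearMap.opNorm_le_bound _ (by positivity) fun v => ?_
    refine ((Ξ.splineDeriv b x).le_opNorm _).trans ?_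
    have h1 := hAc (A'.symm v)
    have h2 : A (A'.symm v) = v := by rw [← hA']; exact A'.apply_symm_apply v
    rw [h2] at h1
    rw [div_mul_eq_mul_div, le_div_iff₀ hc, mul_assoc, mul_comm _ c]
    exact mul_le_mul_of_nonneg_left h1 (norm_nonneg _)
  · refine pow_le_pow_left₀ (norm_nonneg _) ?_ 2
    have h1 : Ξ.splineDeriv b x = ((Ξ.splineDeriv b x).comp (A'.symm : E d →L[ℝ] E d)).comp A := by
      ext1 v
      rw [← hA']
      exact congrArg _ (A'.symm_apply_apply v).symm
    conv_lhs => rw [h1]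
    refine (ContinuousLinearMap.opNorm_comp_le _ _).trans ?_
    rw [mul_comm]
    gcongr

lemma exists_of_mem_patchSpace {Ξ : Fin N → Knots d k} {u : E d → ℝ} (hu : u ∈ G.patchSpace Ξ i) :
    ∃ b : (Ξ i).Index → ℝ, u = (Ξ i).spline b ∘ G.Ψ i := by
  obtain ⟨v, hv, rfl⟩ := hu
  obtain ⟨b, rfl⟩ := (Submodule.mem_span_range_iff_exists_fun ℝ).1 hv
  refine ⟨b, ?_⟩
  funext x
  simp [Knots.spline, mul_comm]

end Multipatch

/-! ### The inverse trace inequality on a patch -/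

namespace Multipatch

variable {n N k : ℕ} {G : Multipatch (n + 1) N} {i : Fin N}

/-- The facets of the cube `[0,1]^{n+1}`, given by a coordinate and its value, `0` or `1`. -/
abbrev FacetIndex (n : ℕ) := Fin (n + 1) × Fin 2

lemma facetIndex_eq (ι : FacetIndex n) : ((ι.2 : ℕ) : ℝ) = 0 ∨ ((ι.2 : ℕ) : ℝ) = 1 := by
  obtain ⟨m, s⟩ := ι; fin_cases s <;> simp

lemma lipschitzOnWith_facet {L : NNReal} (hL : LipschitzOnWith L (G.Φ i) (closedCube (n + 1)))
    (ι : FacetIndex n) :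
    LipschitzOnWith L (fun y => G.Φ i (facetMap ι.1 (ι.2 : ℕ) y)) (closedCube n) := by
  have hmaps : MapsTo (facetMap ι.1 ((ι.2 : ℕ) : ℝ)) (closedCube n) (closedCube (n + 1)) :=
    fun y hy => facetMap_mem_closedCube ι.1
      (by rcases facetIndex_eq ι with h | h <;> simp [h]) hy
  have h := hL.comp (isometry_facetMap ι.1 ((ι.2 : ℕ) : ℝ)).lipschitz.lipschitzOnWith hmaps
  rw [mul_one] at h
  exact h

lemma frontier_subset_iUnion_facet : frontier (G.sub i) ⊆
    ⋃ ι : FacetIndex n, (fun y => G.Φ i (facetMap ι.1 (ι.2 : ℕ) y)) '' closedCube n := by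
  intro x hx
  obtain ⟨z, hz, hz', rfl⟩ := G.exists_of_mem_frontier i hx
  obtain ⟨m, a, ha, y, hy, rfl⟩ := exists_facetMap_eq hz hz'
  rw [mem_iUnion]
  rcases ha with rfl | rfl
  · exact ⟨(m, 0), y, hy, by simp⟩
  · exact ⟨(m, 1), y, hy, by simp⟩

lemma volume_closedCube_lt_top (d : ℕ) : volume (closedCube d) < ⊤ :=
  (isCompact_closedCube d).measure_lt_top

lemma hausdorffMeasure_frontier_lt_top {L : NNReal}
    (hL : LipschitzOnWith L (G.Φ i) (closedCube (n + 1))) :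
    (μHE[n] : Measure (E (n + 1))) (frontier (G.sub i)) < ⊤ := by
  refine (measure_mono frontier_subset_iUnion_facet).trans_lt
    ((measure_iUnion_le _).trans_lt ?_)
  rw [tsum_fintype]
  refine ENNReal.sum_lt_top.2 fun ι _ =>
    (hausdorffMeasure_lipschitz_image_le (lipschitzOnWith_facet hL ι)).trans_lt ?_
  exact ENNReal.mul_lt_top (ENNReal.pow_lt_top ENNReal.coe_lt_top) (volume_closedCube_lt_top n)

lemma lintegral_frontier_le {L : NNReal} (hL : LipschitzOnWith L (G.Φ i) (closedCube (n + 1)))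
    (g : E (n + 1) → ENNReal) :
    ∫⁻ x in frontier (G.sub i), g x ∂(μHE[n] : Measure (E (n + 1)))
      ≤ (L : ENNReal) ^ n * ∑ ι : FacetIndex n,
          ∫⁻ y in closedCube n, g (G.Φ i (facetMap ι.1 (ι.2 : ℕ) y)) := by
  refine (lintegral_mono_set frontier_subset_iUnion_facet).trans
    ((lintegral_iUnion_le _ _).trans ?_)
  rw [tsum_fintype, Finset.mul_sum]
  exact Finset.sum_le_sum fun ι _ => lintegral_lipschitz_image_le (lipschitzOnWith_facet hL ι)
    (isClosed_closedCube n).measurableSet g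

/-- Almost every boundary point of a patch is the image of a regular point. -/
lemma ae_frontier_exists_isRegular {L : NNReal}
    (hL : LipschitzOnWith L (G.Φ i) (closedCube (n + 1))) (Ξ : Knots (n + 1) k) :
    ∀ᵐ x ∂(μHE[n] : Measure (E (n + 1))).restrict (frontier (G.sub i)),
      ∃ z, Ξ.IsRegular z ∧ G.Φ i z = x := by
  rw [ae_restrict_iff' isClosed_frontier.measurableSet]
  have h : ∀ ι : FacetIndex n, _ := fun ι => ae_mem_lipschitz_image (lipschitzOnWith_facet hL ι)
    (Ξ.ae_isRegular_facetMap ι.1 (facetIndex_eq ι))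
  filter_upwards [ae_all_iff.2 h] with x hx hxf
  obtain ⟨ι, hι⟩ := mem_iUnion.1 (frontier_subset_iUnion_facet hxf)
  obtain ⟨y, -, hy, rfl⟩ := hx ι hι
  exact ⟨_, hy, rfl⟩

/-- Almost every point of a patch is the image of a regular point. -/
lemma ae_sub_exists_isRegular {L : NNReal}
    (hL : LipschitzOnWith L (G.Φ i) (closedCube (n + 1))) (Ξ : Knots (n + 1) k) :
    ∀ᵐ x ∂volume.restrict (G.sub i), ∃ z, Ξ.IsRegular z ∧ G.Φ i z = x := by
  rw [ae_restrict_iff' (G.isOpen_sub i).measurableSet]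
  have hreg : ∀ᵐ y : E (n + 1), y ∈ closedCube (n + 1) → Ξ.IsRegular y := by
    filter_upwards [Ξ.ae_forall_ne_knot] with y hy hy'
    exact Knots.isRegular_of_mem_openElements ⟨hy', hy⟩
  have h := ae_mem_lipschitz_image hL hreg
  rw [EuclideanSpace.euclideanHausdorffMeasure_eq_volume] at h
  filter_upwards [h] with x hx hxs
  rw [image_closedCube] at hx
  obtain ⟨y, -, hy, rfl⟩ := hx (subset_closure hxs)
  exact ⟨y, hy, rfl⟩

/-- The squared gradient is integrable on a patch if it is bounded at the images of the regular
points. -/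
lemma integrableOn_norm_gradientWithin_sq {L : NNReal}
    (hL : LipschitzOnWith L (G.Φ i) (closedCube (n + 1))) (Ξ : Knots (n + 1) k)
    {u : E (n + 1) → ℝ} {M : ℝ} (hM : ∀ z, Ξ.IsRegular z →
      ‖gradientWithin u (closure (G.sub i)) (G.Φ i z)‖ ^ 2 ≤ M) :
    IntegrableOn (fun x => ‖gradientWithin u (closure (G.sub i)) x‖ ^ 2) (G.sub i) := by
  have hfin : volume (G.sub i) < ⊤ := by
    refine (measure_mono subset_closure).trans_lt ?_
    rw [← image_closedCube]
    exact ((isCompact_closedCube _).image_of_continuousOn (G.continuousOn i)).measure_lt_top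
  refine IntegrableOn.of_bound (C := M) hfin ?_ ?_
  · refine ((measurable_fderiv ℝ u).norm.pow_const 2).aestronglyMeasurable.congr ?_
    refine (ae_restrict_iff' (G.isOpen_sub i).measurableSet).2 (ae_of_all _ fun x hx => ?_)
    change ‖fderiv ℝ u x‖ ^ 2 = ‖gradientWithin u (closure (G.sub i)) x‖ ^ 2
    rw [gradientWithin, LinearIsometryEquiv.norm_map, fderivWithin_of_mem_nhds
      (mem_of_superset ((G.isOpen_sub i).mem_nhds hx) subset_closure)]
  · filter_upwards [ae_sub_exists_isRegular hL Ξ] with x ⟨z, hz, hzx⟩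
    rw [Real.norm_of_nonneg (sq_nonneg _), ← hzx]
    exact hM z hz

/-- The change of variables `x = Φ_i z`, as an upper bound for integrals over the parametric
domain. -/
lemma lintegral_closedCube_le (Ξ : Knots (n + 1) k)
    {A : E (n + 1) → E (n + 1) →L[ℝ] E (n + 1)} {cm : ℝ} (hcm : 0 < cm)
    (hA : ∀ z, Ξ.IsRegular z → HasFDerivWithinAt (G.Φ i) (A z) (closedCube (n + 1)) z ∧
      cm ≤ |(A z).det|) (f : E (n + 1) → ENNReal) {g : E (n + 1) → ENNReal}
    (hfg : ∀ z, Ξ.IsRegular z → f z ≤ g (G.Φ i z)) :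
    ∫⁻ z in closedCube (n + 1), f z ≤ ENNReal.ofReal cm⁻¹ * ∫⁻ x in G.sub i, g x := by
  have hreg : ∀ z ∈ Ξ.openElements, Ξ.IsRegular z := fun z => Knots.isRegular_of_mem_openElements
  have himage : G.Φ i '' Ξ.openElements ⊆ G.sub i := by
    rw [← image_cube]; exact image_mono Ξ.openElements_subset_openCube
  have hcv := lintegral_image_eq_lintegral_abs_det_fderiv_mul volume Ξ.measurableSet_openElements
    (fun z hz => (hA z (hreg z hz)).1.mono (sep_subset _ _))
    ((G.injOn i).mono (sep_subset _ _)) g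
  calc ∫⁻ z in closedCube (n + 1), f z = ∫⁻ z in Ξ.openElements, f z :=
        setLIntegral_congr Ξ.openElements_ae_eq_closedCube.symm
    _ ≤ ∫⁻ z in Ξ.openElements,
          ENNReal.ofReal cm⁻¹ * (ENNReal.ofReal |(A z).det| * g (G.Φ i z)) := by
        refine setLIntegral_mono' Ξ.measurableSet_openElements fun z hz => ?_
        rw [← mul_assoc, ← ENNReal.ofReal_mul (by positivity)]
        have h1 : (1 : ENNReal) ≤ ENNReal.ofReal (cm⁻¹ * |(A z).det|) := by
          rw [← ENNReal.ofReal_one]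
          refine ENNReal.ofReal_le_ofReal ?_
          rw [le_inv_mul_iff₀ hcm, mul_one]
          exact (hA z (hreg z hz)).2
        calc f z ≤ g (G.Φ i z) := hfg z (hreg z hz)
          _ = 1 * g (G.Φ i z) := (one_mul _).symm
          _ ≤ _ := by gcongr
    _ = ENNReal.ofReal cm⁻¹ * ∫⁻ x in G.Φ i '' Ξ.openElements, g x := by
        rw [lintegral_const_mul' _ _ ENNReal.ofReal_ne_top, hcv]
    _ ≤ _ := by gcongr

/-- The inverse trace inequality for B-splines on a patch. The gradient on the boundary is
represented by a measurable majorant `M` of its squared length. -/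
lemma exists_trace_majorant (G : Multipatch (n + 1) N) (k : ℕ) (θ : ℝ)
    (hex : ∃ Ξ : Fin N → Knots (n + 1) k, ∀ i, (Ξ i).Represents (G.Φ i)) :
    ∃ K > (0 : ℝ), ∀ (Ξ : Fin N → Knots (n + 1) k), (∀ i, (Ξ i).QuasiUniform θ) →
      (∀ i, (Ξ i).Represents (G.Φ i)) → ∀ i, ∀ u ∈ G.patchSpace Ξ i,
      MemLp u 2 ((μHE[n] : Measure (E (n + 1))).restrict (frontier (G.sub i))) ∧
      ∃ M : E (n + 1) → ℝ, (∀ x, 0 ≤ M x) ∧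
        IntegrableOn M (frontier (G.sub i)) (μHE[n] : Measure (E (n + 1))) ∧
        (∀ᵐ x ∂(μHE[n] : Measure (E (n + 1))).restrict (frontier (G.sub i)),
          ‖gradientWithin u (closure (G.sub i)) x‖ ^ 2 ≤ M x) ∧
        (Ξ i).meshSize * ∫ x in frontier (G.sub i), M x ∂(μHE[n] : Measure (E (n + 1)))
          ≤ K * ∫ x in G.sub i, ‖gradientWithin u (closure (G.sub i)) x‖ ^ 2 := by
  obtain ⟨L, hL⟩ := G.exists_lipschitzOnWith hex
  obtain ⟨cm, cM, hcm, hreg⟩ := G.regular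
  obtain ⟨c, hc, hinv⟩ := exists_mul_norm_le_norm_apply (n + 1) L hcm
  obtain ⟨C, hC, htrace⟩ := Knots.exists_lintegral_facet_le k
  let K₀ : ℝ := L ^ n * (Fintype.card (FacetIndex n) * ((c ^ 2)⁻¹ * (θ ^ 2 * C * (cm⁻¹ * L ^ 2))))
  have hK₀ : 0 ≤ K₀ := by positivity
  -- `K₀` may vanish, for instance if `θ = 0`, hence the summand `1`.
  refine ⟨K₀ + 1, by positivity, fun Ξ hΞ hrep i u hu => ?_⟩
  obtain ⟨b, rfl⟩ := exists_of_mem_patchSpace hu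
  obtain ⟨q, hq⟩ := hrep i
  have hA := fun z (hz : (Ξ i).IsRegular z) =>
    bounds_splineDeriv (G := G) (i := i) hq (hL i) (fun x hx hd => (hreg i x hx hd).1) hz
  have hgrad := fun z (hz : (Ξ i).IsRegular z) =>
    gradientWithin_bounds (G := G) (i := i) hz (hA z hz).1 (hA z hz).2.1 hc
      (hinv _ (hA z hz).2.1 (hA z hz).2.2) b
  set u := (Ξ i).spline b ∘ G.Ψ i
  have hfs : frontier (G.sub i) ⊆ closure (G.sub i) := frontier_subset_closure
  have hΨ := G.aemeasurable_Ψ i hfs isClosed_frontier.measurableSet μHE[n]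
  have hΨmem : ∀ x ∈ frontier (G.sub i), G.Ψ i x ∈ closedCube (n + 1) := by
    intro x hx
    obtain ⟨z, hz, -, rfl⟩ := G.exists_of_mem_frontier i hx
    rwa [G.Ψ_Φ i hz]
  have hfin := hausdorffMeasure_frontier_lt_top (hL i)
  have : IsFiniteMeasure ((μHE[n] : Measure (E (n + 1))).restrict (frontier (G.sub i))) :=
    ⟨by rwa [Measure.restrict_apply_univ]⟩
  have hae : ∀ {p : E (n + 1) → Prop}, (∀ x ∈ frontier (G.sub i), p x) →
      ∀ᵐ x ∂(μHE[n] : Measure (E (n + 1))).restrict (frontier (G.sub i)), p x := fun h =>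
    (ae_restrict_iff' isClosed_frontier.measurableSet).2 (ae_of_all _ h)
  obtain ⟨B, hB⟩ := Knots.exists_forall_norm_spline_le b
  obtain ⟨B', hB'⟩ := Knots.exists_forall_gradSq_le b
  have hMint : IntegrableOn (fun x => (c ^ 2)⁻¹ * (Ξ i).gradSq b (G.Ψ i x))
      (frontier (G.sub i)) (μHE[n] : Measure (E (n + 1))) := by
    refine Integrable.const_mul (IntegrableOn.of_bound hfin
      ((Knots.measurable_gradSq b).comp_aemeasurable hΨ).aestronglyMeasurable B' ?_) _
    refine hae fun x hx => ?_
    rw [Function.comp_apply, Real.norm_of_nonneg (Knots.gradSq_nonneg _ _)]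
    exact hB' _ (hΨmem x hx)
  refine ⟨MemLp.of_bound ((Knots.measurable_spline b).comp_aemeasurable hΨ).aestronglyMeasurable B
    (hae fun x hx => hB _ (hΨmem x hx)), fun x => (c ^ 2)⁻¹ * (Ξ i).gradSq b (G.Ψ i x),
    fun x => mul_nonneg (by positivity) (Knots.gradSq_nonneg _ _), hMint, ?_, ?_⟩
  · filter_upwards [ae_frontier_exists_isRegular (hL i) (Ξ i)] with x ⟨z, hz, hzx⟩
    rw [← hzx, G.Ψ_Φ i hz.mem_closedCube, le_inv_mul_iff₀ (by positivity)]
    exact (hgrad z hz).1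
  · have hint : IntegrableOn (fun x => ‖gradientWithin u (closure (G.sub i)) x‖ ^ 2) (G.sub i) := by
      refine integrableOn_norm_gradientWithin_sq (hL i) (Ξ i) (M := (c ^ 2)⁻¹ * B') fun z hz => ?_
      rw [le_inv_mul_iff₀ (by positivity)]
      exact (hgrad z hz).1.trans (hB' z hz.mem_closedCube)
    set I := ∫ x in G.sub i, ‖gradientWithin u (closure (G.sub i)) x‖ ^ 2
    have hI0 : 0 ≤ I := integral_nonneg fun _ => sq_nonneg _
    have hh := Knots.meshSize_pos (0 : Fin (n + 1)) (Ξ i)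
    have hbulk : ∫⁻ z in closedCube (n + 1), ENNReal.ofReal ((Ξ i).gradSq b z)
        ≤ ENNReal.ofReal (cm⁻¹ * L ^ 2) * ENNReal.ofReal I := by
      rw [ENNReal.ofReal_mul (by positivity), mul_assoc,
        ofReal_integral_eq_lintegral_ofReal hint (ae_of_all _ fun _ => sq_nonneg _),
        ← lintegral_const_mul' _ _ ENNReal.ofReal_ne_top]
      simp only [← ENNReal.ofReal_mul (show (0 : ℝ) ≤ (L : ℝ) ^ 2 by positivity)]
      exact lintegral_closedCube_le (G := G) (i := i) (Ξ i) hcm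
        (fun z hz => ⟨(hA z hz).1, (hA z hz).2.2⟩) _
        fun z hz => ENNReal.ofReal_le_ofReal (hgrad z hz).2
    have hfacet : ∀ ι : FacetIndex n, ENNReal.ofReal (Ξ i).meshSize *
        ∫⁻ y in closedCube n, ENNReal.ofReal ((c ^ 2)⁻¹ *
          (Ξ i).gradSq b (G.Ψ i (G.Φ i (facetMap ι.1 (ι.2 : ℕ) y))))
        ≤ ENNReal.ofReal ((c ^ 2)⁻¹ * (θ ^ 2 * C * (cm⁻¹ * L ^ 2)) * I) := by
      intro ι
      have h1 : ∫⁻ y in closedCube n, ENNReal.ofReal ((c ^ 2)⁻¹ *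
          (Ξ i).gradSq b (G.Ψ i (G.Φ i (facetMap ι.1 (ι.2 : ℕ) y))))
          = ENNReal.ofReal (c ^ 2)⁻¹ * ∫⁻ y in closedCube n,
            ENNReal.ofReal ((Ξ i).gradSq b (facetMap ι.1 (ι.2 : ℕ) y)) := by
        rw [← lintegral_const_mul' _ _ ENNReal.ofReal_ne_top]
        refine setLIntegral_congr_fun (isClosed_closedCube n).measurableSet fun y hy => ?_
        rw [G.Ψ_Φ i (facetMap_mem_closedCube ι.1
          (by rcases facetIndex_eq ι with h | h <;> simp [h]) hy),
          ENNReal.ofReal_mul (by positivity)]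
      rw [h1, mul_left_comm]
      refine (mul_le_mul_right ((htrace n (Ξ i) θ (hΞ i) b ι.1 _ (facetIndex_eq ι)).trans
        (mul_le_mul_right hbulk _)) _).trans (le_of_eq ?_)
      rw [← ENNReal.ofReal_mul (by positivity), ← ENNReal.ofReal_mul (by positivity),
        ← ENNReal.ofReal_mul (by positivity)]
      congr 1
      ring
    refine le_trans ?_ (mul_le_mul_of_nonneg_right (le_add_of_nonneg_right zero_le_one) hI0)
    rw [← ENNReal.ofReal_le_ofReal_iff (by positivity), ENNReal.ofReal_mul hh.le,
      ofReal_integral_eq_lintegral_ofReal hMint (ae_of_all _ fun x =>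
        mul_nonneg (by positivity) (Knots.gradSq_nonneg _ _))]
    refine (mul_le_mul_right (lintegral_frontier_le (hL i) _) _).trans ?_
    rw [mul_left_comm, Finset.mul_sum]
    refine (mul_le_mul_right (Finset.sum_le_sum fun ι _ => hfacet ι) _).trans (le_of_eq ?_)
    rw [Finset.sum_const, Finset.card_univ, nsmul_eq_mul, ← ENNReal.ofReal_natCast,
      ← ENNReal.ofReal_mul (by positivity), ← ENNReal.ofReal_coe_nnreal,
      ← ENNReal.ofReal_pow (by positivity), ← ENNReal.ofReal_mul (by positivity)]
    congr 1
    simp only [K₀]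
    ring

end Multipatch

/-! ### Coercivity -/

lemma norm_outerNormal_le_one {d : ℕ} (S : Set (E d)) (x : E d) : ‖outerNormal S x‖ ≤ 1 := by
  unfold outerNormal
  split_ifs with h
  · exact h.choose_spec.1.le
  · simp

lemma surfaceIntegral_eq {n : ℕ} (F : Set (E (n + 1))) (f : E (n + 1) → ℝ) :
    surfaceIntegral F f = ∫ x in F, f x ∂(μHE[n] : Measure (E (n + 1))) := rfl

/-- Young's inequality, with the weight `δ h` adapted to the mesh size. -/
lemma mul_mul_abs_le {a h δ g M w : ℝ} (ha : 0 < a) (hh : 0 < h) (hδ : 0 < δ) (hg : g ^ 2 ≤ M) :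
    a * |g| * |w| ≤ δ * (a * (h * M)) + 1 / (4 * δ) * (a / h * w ^ 2) := by
  have h1 : 0 ≤ a / (4 * δ * h) * (2 * δ * h * |g| - |w|) ^ 2 := by positivity
  have h2 : a / (4 * δ * h) * (2 * δ * h * |g| - |w|) ^ 2
      = δ * (a * (h * |g| ^ 2)) + 1 / (4 * δ) * (a / h * |w| ^ 2) - a * |g| * |w| := by
    field_simp
    ring
  rw [h2, sq_abs, sq_abs] at h1
  have h3 : δ * (a * (h * g ^ 2)) ≤ δ * (a * (h * M)) := by gcongr
  linarith

/-- The bound of a consistency term by gradients and jumps. The integrand `f` need not be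
measurable: otherwise its integral is zero. -/
lemma abs_integral_flux_le {X : Type*} [MeasurableSpace X] {ν : Measure X}
    {f w M₁ M₂ g₁ g₂ : X → ℝ} {a₁ a₂ h₁ h₂ δ : ℝ} (ha₁ : 0 < a₁) (ha₂ : 0 < a₂) (hh₁ : 0 < h₁)
    (hh₂ : 0 < h₂) (hδ : 0 < δ) (hw : MemLp w 2 ν) (hM₁ : Integrable M₁ ν) (hM₂ : Integrable M₂ ν)
    (hg₁ : ∀ᵐ x ∂ν, g₁ x ^ 2 ≤ M₁ x) (hg₂ : ∀ᵐ x ∂ν, g₂ x ^ 2 ≤ M₂ x)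
    (hf : ∀ x, |f x| ≤ (a₁ * |g₁ x| + a₂ * |g₂ x|) * |w x|) :
    |∫ x, f x ∂ν| ≤ δ * (a₁ * (h₁ * ∫ x, M₁ x ∂ν) + a₂ * (h₂ * ∫ x, M₂ x ∂ν))
      + 1 / (4 * δ) * ∫ x, (a₂ / h₂ + a₁ / h₁) * w x ^ 2 ∂ν := by
  have hi₁ := (hM₁.const_mul h₁).const_mul a₁
  have hi₂ := (hM₂.const_mul h₂).const_mul a₂
  have hi := (hi₁.add hi₂).const_mul δ
  have hiw := (hw.integrable_sq.const_mul (a₂ / h₂ + a₁ / h₁)).const_mul (1 / (4 * δ))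
  have hle := norm_integral_le_of_norm_le (f := f) (hi.add hiw) (by
    filter_upwards [hg₁, hg₂] with x hx₁ hx₂
    have h1 := mul_mul_abs_le (w := w x) ha₁ hh₁ hδ hx₁
    have h2 := mul_mul_abs_le (w := w x) ha₂ hh₂ hδ hx₂
    refine (hf x).trans ?_
    simp only [Pi.add_apply]
    linarith)
  refine hle.trans (le_of_eq ?_)
  have e1 := integral_add hi hiw
  have e2 := integral_add hi₁ hi₂
  simp only [Pi.add_apply] at e1 e2 ⊢
  rw [e1, integral_const_mul, integral_const_mul, e2, integral_const_mul, integral_const_mul,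
    integral_const_mul, integral_const_mul]

lemma abs_inner_mul_add_le {d : ℕ} {g₁ g₂ ν : E d} (hν : ‖ν‖ ≤ 1) {a₁ a₂ : ℝ} (ha₁ : 0 < a₁)
    (ha₂ : 0 < a₂) (w : ℝ) :
    |inner ℝ ((1 / 2 : ℝ) • (a₁ • g₁ + a₂ • g₂)) ν * w
        + inner ℝ ((1 / 2 : ℝ) • (a₁ • g₁ + a₂ • g₂)) ν * w|
      ≤ (a₁ * |‖g₁‖| + a₂ * |‖g₂‖|) * |w| := by
  have h1 : inner ℝ ((1 / 2 : ℝ) • (a₁ • g₁ + a₂ • g₂)) ν * w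
      + inner ℝ ((1 / 2 : ℝ) • (a₁ • g₁ + a₂ • g₂)) ν * w = inner ℝ (a₁ • g₁ + a₂ • g₂) ν * w := by
    rw [real_inner_smul_left]; ring
  rw [h1, abs_mul, abs_norm, abs_norm]
  gcongr
  calc |inner ℝ (a₁ • g₁ + a₂ • g₂) ν| ≤ ‖a₁ • g₁ + a₂ • g₂‖ * ‖ν‖ := abs_real_inner_le_norm _ _
    _ ≤ ‖a₁ • g₁ + a₂ • g₂‖ * 1 := by gcongr
    _ ≤ ‖a₁ • g₁‖ + ‖a₂ • g₂‖ := by rw [mul_one]; exact norm_add_le _ _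
    _ = a₁ * ‖g₁‖ + a₂ * ‖g₂‖ := by
      rw [norm_smul, norm_smul, Real.norm_of_nonneg ha₁.le, Real.norm_of_nonneg ha₂.le]

namespace Multipatch

variable {d n N k : ℕ}

lemma formA_self (G : Multipatch d N) (α : Fin N → ℝ) (i : Fin N) (u : Fin N → E d → ℝ) :
    G.formA α i u u = α i * ∫ x in G.sub i, ‖G.grad u i x‖ ^ 2 := by
  simp only [formA, real_inner_self_eq_norm_sq, integral_const_mul]

lemma formP_self (G : Multipatch d N) (Ξ : Fin N → Knots d k) (α : Fin N → ℝ) (μ : ℝ) (i : Fin N)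
    (u : Fin N → E d → ℝ) : G.formP Ξ α μ i u u = μ * G.formP Ξ α 1 i u u := by
  simp only [formP, surfaceIntegral, mul_add, Finset.mul_sum, ← integral_const_mul]
  congr 1
  · refine Finset.sum_congr rfl fun j _ => ?_
    congr 1; funext x; ring
  · congr 1; funext x; ring

lemma formP_one_nonneg (G : Multipatch d N) {Ξ : Fin N → Knots d k} {α : Fin N → ℝ}
    (hα : ∀ i, 0 < α i) (hh : ∀ i, 0 < (Ξ i).meshSize) (i : Fin N) (u : Fin N → E d → ℝ) :
    0 ≤ G.formP Ξ α 1 i u u := by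
  have hpos := fun j => (div_pos (hα j) (hh j)).le
  refine add_nonneg (Finset.sum_nonneg fun j _ => integral_nonneg fun x => ?_)
    (integral_nonneg fun x => ?_)
  · have := mul_nonneg (add_nonneg (hpos j) (hpos i)) (mul_self_nonneg (jump u i j x))
    simp only [Pi.zero_apply]
    linarith
  · have := mul_nonneg (hpos i) (mul_self_nonneg (u i x))
    simp only [Pi.zero_apply]
    linarith

/-- The consistency terms of a patch are controlled by gradients on the adjacent patches, with a
small factor, and by the penalty terms. -/
lemma half_formS_le (G : Multipatch (n + 1) N) {Ξ : Fin N → Knots (n + 1) k} {α : Fin N → ℝ}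
    (hα : ∀ i, 0 < α i) {u : Fin N → E (n + 1) → ℝ} {M : Fin N → E (n + 1) → ℝ} {K δ : ℝ}
    (hδ : 0 < δ)
    (hu : ∀ i, MemLp (u i) 2 ((μHE[n] : Measure (E (n + 1))).restrict (frontier (G.sub i))))
    (hM0 : ∀ i x, 0 ≤ M i x)
    (hM : ∀ i, IntegrableOn (M i) (frontier (G.sub i)) (μHE[n] : Measure (E (n + 1))))
    (hgM : ∀ i, ∀ᵐ x ∂(μHE[n] : Measure (E (n + 1))).restrict (frontier (G.sub i)),
      ‖G.grad u i x‖ ^ 2 ≤ M i x)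
    (hK : ∀ i, (Ξ i).meshSize * ∫ x in frontier (G.sub i), M i x ∂(μHE[n] : Measure (E (n + 1)))
      ≤ K * ∫ x in G.sub i, ‖G.grad u i x‖ ^ 2) (i : Fin N) :
    1 / 2 * G.formS α i u u ≤ δ * K * ((∑ j, (G.formA α i u u + G.formA α j u u) / 2)
      + G.formA α i u u) + 1 / (4 * δ) * G.formP Ξ α 1 i u u := by
  have hh : ∀ i, 0 < (Ξ i).meshSize := fun i => Knots.meshSize_pos 0 (Ξ i)
  have hmono : ∀ j, ∀ F ⊆ frontier (G.sub j),
      α j * ((Ξ j).meshSize * ∫ x in F, M j x ∂(μHE[n] : Measure (E (n + 1))))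
        ≤ K * G.formA α j u u := by
    intro j F hF
    have h1 := setIntegral_mono_set (hM j) (ae_of_all _ (hM0 j)) hF.eventuallyLE
    have h2 := mul_le_mul_of_nonneg_left ((mul_le_mul_of_nonneg_left h1 (hh j).le).trans (hK j))
      (hα j).le
    rw [formA_self]
    linarith
  have hA0 : ∀ j, 0 ≤ K * G.formA α j u u := fun j => by
    refine le_trans ?_ (hmono j ∅ (empty_subset _))
    simp
  have hface : ∀ j, 1 / 2 * surfaceIntegral (G.face i j) (fun x =>
      inner ℝ (G.avgFlux α u i j x) (G.normal i x) * jump u i j x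
        + inner ℝ (G.avgFlux α u i j x) (G.normal i x) * jump u i j x)
      ≤ δ * K * ((G.formA α i u u + G.formA α j u u) / 2)
        + 1 / (4 * δ) * surfaceIntegral (G.face i j) (fun x =>
          1 * (α j / (Ξ j).meshSize + α i / (Ξ i).meshSize) * jump u i j x * jump u i j x) := by
    intro j
    have hi : G.face i j ⊆ frontier (G.sub i) := inter_subset_left
    have hj : G.face i j ⊆ frontier (G.sub j) := inter_subset_right
    have hw : MemLp (jump u i j) 2 ((μHE[n] : Measure (E (n + 1))).restrict (G.face i j)) :=
      ((hu i).mono_measure (Measure.restrict_mono hi le_rfl)).sub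
        ((hu j).mono_measure (Measure.restrict_mono hj le_rfl))
    have key := abs_integral_flux_le (hα i) (hα j) (hh i) (hh j) hδ hw ((hM i).mono_set hi)
      ((hM j).mono_set hj) (ae_restrict_of_ae_restrict_of_subset hi (hgM i))
      (ae_restrict_of_ae_restrict_of_subset hj (hgM j))
      (fun x => abs_inner_mul_add_le (g₁ := G.grad u i x) (g₂ := G.grad u j x)
        (norm_outerNormal_le_one (G.sub i) x) (hα i) (hα j) (jump u i j x))
    have hP : ∫ x in G.face i j, (α j / (Ξ j).meshSize + α i / (Ξ i).meshSize) * jump u i j x ^ 2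
          ∂(μHE[n] : Measure (E (n + 1)))
        = surfaceIntegral (G.face i j) (fun x =>
          1 * (α j / (Ξ j).meshSize + α i / (Ξ i).meshSize) * jump u i j x * jump u i j x) := by
      rw [surfaceIntegral_eq]
      congr 1; funext x; ring
    have hP0 : 0 ≤ surfaceIntegral (G.face i j) (fun x =>
        1 * (α j / (Ξ j).meshSize + α i / (Ξ i).meshSize) * jump u i j x * jump u i j x) := by
      rw [← hP]
      have := div_pos (hα i) (hh i)
      have := div_pos (hα j) (hh j)
      exact integral_nonneg fun x => mul_nonneg (by positivity) (sq_nonneg _)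
    rw [hP] at key
    have h1 := mul_le_mul_of_nonneg_left (add_le_add (hmono i _ hi) (hmono j _ hj)) hδ.le
    have h2 := (le_abs_self _).trans key
    have h3 : 0 ≤ 1 / (4 * δ) * surfaceIntegral (G.face i j) (fun x =>
        1 * (α j / (Ξ j).meshSize + α i / (Ξ i).meshSize) * jump u i j x * jump u i j x) := by
      positivity
    have h4 : surfaceIntegral (G.face i j) (fun x =>
        inner ℝ (G.avgFlux α u i j x) (G.normal i x) * jump u i j x
          + inner ℝ (G.avgFlux α u i j x) (G.normal i x) * jump u i j x) ≤ _ := h2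
    linarith
  have hbdry : 1 / 2 * surfaceIntegral (G.boundaryFace i) (fun x =>
      inner ℝ (α i • G.grad u i x) (G.normal i x) * u i x
        + inner ℝ (α i • G.grad u i x) (G.normal i x) * u i x)
      ≤ δ * K * G.formA α i u u + 1 / (4 * δ) * surfaceIntegral (G.boundaryFace i) (fun x =>
          1 * (α i / (Ξ i).meshSize) * u i x * u i x) := by
    have hi : G.boundaryFace i ⊆ frontier (G.sub i) := inter_subset_left
    have hw := (hu i).mono_measure (Measure.restrict_mono hi (le_refl μHE[n]))
    have hg := ae_restrict_of_ae_restrict_of_subset hi (hgM i)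
    have key := abs_integral_flux_le (hα i) (hα i) (hh i) (hh i) hδ hw ((hM i).mono_set hi)
      ((hM i).mono_set hi) hg hg
      (fun x => abs_inner_mul_add_le (g₁ := G.grad u i x) (g₂ := G.grad u i x)
        (norm_outerNormal_le_one (G.sub i) x) (hα i) (hα i) (u i x))
    have hP : ∫ x in G.boundaryFace i, (α i / (Ξ i).meshSize + α i / (Ξ i).meshSize) * u i x ^ 2
          ∂(μHE[n] : Measure (E (n + 1)))
        = 2 * surfaceIntegral (G.boundaryFace i) (fun x =>
          1 * (α i / (Ξ i).meshSize) * u i x * u i x) := by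
      rw [surfaceIntegral_eq, ← integral_const_mul]
      congr 1; funext x; ring
    have hS : ∀ g : E (n + 1), (1 / 2 : ℝ) • (α i • g + α i • g) = α i • g := fun g => by
      rw [← two_smul ℝ (α i • g), smul_smul]; norm_num
    simp only [hS] at key
    rw [hP] at key
    have h1 := mul_le_mul_of_nonneg_left (add_le_add (hmono i _ hi) (hmono i _ hi)) hδ.le
    have h2 : surfaceIntegral (G.boundaryFace i) (fun x =>
        inner ℝ (α i • G.grad u i x) (G.normal i x) * u i x
          + inner ℝ (α i • G.grad u i x) (G.normal i x) * u i x) ≤ _ := (le_abs_self _).trans key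
    linarith
  have hsum : ∑ j ∈ Finset.univ.filter (fun j => j ≠ i),
      δ * K * ((G.formA α i u u + G.formA α j u u) / 2)
        ≤ ∑ j, δ * K * ((G.formA α i u u + G.formA α j u u) / 2) := by
    refine Finset.sum_le_sum_of_subset_of_nonneg (Finset.filter_subset _ _) fun j _ _ => ?_
    have := mul_nonneg hδ.le (add_nonneg (hA0 i) (hA0 j))
    linarith
  have hfaces := Finset.sum_le_sum
    fun j (_ : j ∈ Finset.univ.filter (fun j => j ≠ i)) => hface j
  rw [Finset.sum_add_distrib] at hfaces
  simp only [← Finset.mul_sum] at hfaces hsum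
  unfold formS formP
  linarith

end Multipatch

end IgA

end

theorem mainTheorem3 {d N k : ℕ} (hd : d = 2 ∨ d = 3) (G : IgA.Multipatch d N) (θ : ℝ) :
    ∃ μ₀ > (0 : ℝ), ∃ C > (0 : ℝ),
      ∀ Ξ : Fin N → IgA.Knots d k,
        (∀ i, IgA.Knots.QuasiUniform (Ξ i) θ) →
        (∀ i, IgA.Knots.Represents (Ξ i) (G.Φ i)) →
        ∀ α : Fin N → ℝ, (∀ i, 0 < α i) →
        ∀ μ : ℝ, μ₀ ≤ μ →
        ∀ u ∈ G.space Ξ, C * G.dgNorm Ξ α μ u ^ 2 ≤ G.formH Ξ α μ u u := by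
  obtain ⟨n, rfl⟩ : ∃ n, d = n + 1 := by
    rcases hd with rfl | rfl
    exacts [⟨1, rfl⟩, ⟨2, rfl⟩]
  -- The Lipschitz constant of the parametrizations is obtained from one family of meshes that
  -- represents them; if there is none, nothing has to be shown.
  by_cases hex : ∃ Ξ : Fin N → IgA.Knots (n + 1) k, ∀ i, (Ξ i).Represents (G.Φ i)
  swap
  · exact ⟨1, one_pos, 1, one_pos, fun Ξ _ hrep => absurd ⟨Ξ, hrep⟩ hex⟩
  obtain ⟨K, hK, htrace⟩ := G.exists_trace_majorant k θ hex
  refine ⟨K * (N + 1), by positivity, 1 / 2, by norm_num,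
    fun Ξ hΞ hrep α hα μ hμ u hu => ?_⟩
  have hh : ∀ i, 0 < (Ξ i).meshSize := fun i => IgA.Knots.meshSize_pos 0 (Ξ i)
  choose hmem M hM0 hM hgM hMK using fun i => htrace Ξ hΞ hrep i (u i) (hu i (Set.mem_univ i))
  have hμ0 : 0 < μ := lt_of_lt_of_le (by positivity) hμ
  -- With this `δ` the consistency terms use up half of the gradient terms.
  set δ : ℝ := 1 / (2 * K * (N + 1)) with hδ
  have hδ0 : 0 < δ := by positivity
  have hS := Finset.sum_le_sum fun i (_ : i ∈ Finset.univ) =>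
    G.half_formS_le (Ξ := Ξ) hα hδ0 hmem hM0 hM hgM hMK i
  have hAnn : ∀ i, 0 ≤ G.formA α i u u := fun i => by
    rw [IgA.Multipatch.formA_self]
    exact mul_nonneg (hα i).le (MeasureTheory.integral_nonneg fun _ => sq_nonneg _)
  have hPnn := fun i => G.formP_one_nonneg hα hh i u
  set A := ∑ i, G.formA α i u u with hA
  set P := ∑ i, G.formP Ξ α 1 i u u with hP
  have hP0 : 0 ≤ P := Finset.sum_nonneg fun i _ => hPnn i
  have hA0 : 0 ≤ A := Finset.sum_nonneg fun i _ => hAnn i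
  have hnorm : G.dgNorm Ξ α μ u ^ 2 = A + μ * P := by
    have hsum : ∑ i, (α i * (∫ x in G.sub i, ‖G.grad u i x‖ ^ 2) + G.formP Ξ α μ i u u)
        = A + μ * P := by
      rw [Finset.sum_add_distrib, hA, hP, Finset.mul_sum]
      simp only [IgA.Multipatch.formA_self, ← IgA.Multipatch.formP_self]
    rw [IgA.Multipatch.dgNorm, hsum, Real.sq_sqrt (by positivity)]
  have hform : G.formH Ξ α μ u u = A - 1 / 2 * ∑ i, G.formS α i u u + μ * P := by
    rw [IgA.Multipatch.formH, Finset.sum_sub_distrib, hP, Finset.mul_sum, Finset.mul_sum]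
    simp only [← IgA.Multipatch.formP_self]
    ring
  have hdouble : ∑ i, ((∑ j, (G.formA α i u u + G.formA α j u u) / 2) + G.formA α i u u)
      = (N + 1) * A := by
    simp only [Finset.sum_add_distrib, ← Finset.sum_div, ← hA, Finset.sum_const, Finset.card_univ,
      Fintype.card_fin, nsmul_eq_mul, ← Finset.mul_sum]
    ring
  rw [Finset.sum_add_distrib, ← Finset.mul_sum, ← Finset.mul_sum, ← Finset.mul_sum, hdouble,
    ← hP] at hS
  have h1 : δ * K * ((N + 1) * A) = 1 / 2 * A := by
    rw [hδ]; field_simp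
  have h2 : 1 / (4 * δ) = 1 / 2 * (K * (N + 1)) := by
    rw [hδ]; field_simp; norm_num
  rw [h1, h2] at hS
  have h3 : 1 / 2 * (K * (N + 1)) * P ≤ 1 / 2 * μ * P := by gcongr
  rw [hnorm, hform]
  linarith
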